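/- Consider noiseless nonadaptive group testing with $n$ items, a defective set $\mathcal K\subseteq\{1,\dots,n\}$ of known size $k$, and $T$ tests. In a Bernoulli($p$) design each item is placed in each test independently with probability $p\in[0,1]$; a test is positive exactly when it contains a defective item. A detection algorithm maps the design $\mathsf X$ and the outcomes $\mathbf y\in\{0,1\}^T$ to an estimate $\hat{\mathcal K}$, and its average error probability is $$\epsilon=\binom nk^{-1}\sum_{|\mathcal K|=k}\mathbb P\big(\hat{\mathcal K}\ne\mathcal K\mid\text{defective set }\mathcal K\big).$$ A set $\mathcal L$ is satisfying if it would have produced the observed outcomes had it been the defective set; a smallest-satisfying-set (SSS) algorithm outputs a satisfying set of minimum cardinality, with ties broken in an arbitrary way. Let $\theta\in[0,1)$ and $k=k(n)=\Theta(n^\theta)$. A rate $R>0$ is achievable by given detection algorithms if there are $T=T(n)\le\log_2\binom nk/R$ (for all large $n$) and $p=p(n)\in[0,1]$ such that the average error probability tends to $0$ as $n\to\infty$; it is achievable by Bernoulli nonadaptive testing if it is achievable by some detection algorithms. The capacity is the supremum of the achievable rates. Let $h(x)=x\log_2\frac1x+(1-x)\log_2\frac1{1-x}$ and $$C(\theta)=\max_{\nu>0}\min\Big\{\frac{\nu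 e^{-\nu}}{\ln 2}\,\frac{1-\theta}{\theta},\;h(e^{-\nu})\Big\},$$ where for $\theta=0$ the first term is read as $+\infty$. Then, for every $\theta\in[0,1)$, every such sequence $k(n)$ and every choice of tie-breaking, the SSS algorithm is optimal: the supremum of the rates achievable by SSS with Bernoulli designs equals the Bernoulli nonadaptive capacity (the supremum of the rates achievable by Bernoulli designs with any detection algorithms), and both equal $C(\theta)$. -/

import Mathlib

open Filter Topology Asymptotics

noncomputable section

namespace GroupTesting

/-- A test design for `n` items and `T` tests: `X i t = true` when item `i` is in test `t`. -/
abbrev Design (n T : ℕ) : Type := Fin n → Fin T → Bool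

/-- The outcomes of the tests when the defective set is `K`:
test `t` is positive exactly when it contains an item of `K`. -/
def outcome {n T : ℕ} (X : Design n T) (K : Finset (Fin n)) : Fin T → Bool :=
  fun t => decide (∃ i ∈ K, X i t = true)

/-- A set is satisfying for the outcomes `y` if it would have produced the same outcomes
had it been the defective set. -/
def IsSatisfying {n T : ℕ} (X : Design n T) (y : Fin T → Bool) (L : Finset (Fin n)) : Prop :=
  outcome X L = y

/-- A detection algorithm estimates the defective set from the design and the outcomes.
The parameters `n`, `T` (and the number of defectives) are known to it: algorithms are chosen
separately for each problem size. -/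
abbrev Detector (n T : ℕ) : Type := Design n T → (Fin T → Bool) → Finset (Fin n)

/-- The smallest-satisfying-set rule: whenever a satisfying set exists, the output is a satisfying
set of smallest cardinality. Ties may be broken in any way. -/
def IsSSS {n T : ℕ} (D : Detector n T) : Prop :=
  ∀ (X : Design n T) (y : Fin T → Bool), (∃ L, IsSatisfying X y L) →
    IsSatisfying X y (D X y) ∧ ∀ L, IsSatisfying X y L → (D X y).card ≤ L.card

/-- SSS algorithms exist. -/
theorem exists_isSSS (n T : ℕ) : ∃ D : Detector n T, IsSSS D := by
  have h : ∀ (X : Design n T) (y : Fin T → Bool), ∃ M : Finset (Fin n),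
      (∃ L, IsSatisfying X y L) →
        IsSatisfying X y M ∧ ∀ L, IsSatisfying X y L → M.card ≤ L.card := by
    intro X y
    by_cases hne : ∃ L, IsSatisfying X y L
    · obtain ⟨M, hM, hmin⟩ := Set.exists_min_image {L | IsSatisfying X y L} Finset.card
        (Set.toFinite _) hne
      exact ⟨M, fun _ => ⟨hM, hmin⟩⟩
    · exact ⟨∅, fun h => absurd h hne⟩
  choose D hD using h
  exact ⟨D, hD⟩

/-- The probability of the design `X` under Bernoulli(`p`) testing: each item is placed in each
test independently with probability `p`. -/
def designProb {n T : ℕ} (p : ℝ) (X : Design n T) : ℝ :=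
  ∏ i, ∏ t, if X i t = true then p else 1 - p

/-- The average error probability of the detection algorithm `D` for Bernoulli(`p`) testing:
the probability over the random design that the estimate differs from the defective set,
averaged over all defective sets of size `k`. -/
def errorProb {n T : ℕ} (p : ℝ) (k : ℕ) (D : Detector n T) : ℝ :=
  (1 / (n.choose k : ℝ)) * ∑ K ∈ Finset.powersetCard k (Finset.univ : Finset (Fin n)),
    ∑ X : Design n T, if D X (outcome X K) ≠ K then designProb p X else 0

/-- The rate `R` is achieved, with `k n` defectives among `n` items, by Bernoulli designs decoded
with the algorithms `D n T`: for suitable test numbers `T n ≤ log₂ (n choose k n) / R` and suitable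
Bernoulli parameters `p n`, the average error probability tends to `0`. -/
def AchievesRate (k : ℕ → ℕ) (D : ∀ n T, Detector n T) (R : ℝ) : Prop :=
  0 < R ∧ ∃ (T : ℕ → ℕ) (p : ℕ → ℝ), (∀ n, 0 ≤ p n ∧ p n ≤ 1) ∧
    (∀ᶠ n in atTop, (T n : ℝ) ≤ Real.logb 2 (n.choose (k n)) / R) ∧
    Tendsto (fun n => errorProb (p n) (k n) (D n (T n))) atTop (𝓝 0)

/-- The rate `R` is achievable by Bernoulli nonadaptive testing (with some detection algorithm). -/
def RateAchievable (k : ℕ → ℕ) (R : ℝ) : Prop :=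
  ∃ D : ∀ n T, Detector n T, AchievesRate k D R

/-- Binary entropy in bits, `h x = x log₂ (1/x) + (1-x) log₂ (1/(1-x))`. -/
def h (x : ℝ) : ℝ := Real.binEntropy x / Real.log 2

theorem h_eq (x : ℝ) :
    h x = x * Real.logb 2 (1 / x) + (1 - x) * Real.logb 2 (1 / (1 - x)) := by
  simp only [h, Real.binEntropy, Real.logb, one_div]
  ring

/-- The function of `ν` maximised in the capacity formula. At `θ = 0` the quotient `(1 - θ) / θ`
is read as `+∞`, so that only the entropy term remains. -/
def capacityTerm (θ ν : ℝ) : ℝ :=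
  if θ = 0 then h (Real.exp (-ν))
  else min (ν * Real.exp (-ν) / Real.log 2 * ((1 - θ) / θ)) (h (Real.exp (-ν)))

/-- `C(θ) = max_{ν > 0} min {(ν e^{-ν} / ln 2) (1 - θ) / θ, h (e^{-ν})}`. -/
def capacity (θ : ℝ) : ℝ := sSup (capacityTerm θ '' Set.Ioi 0)

/-- The supremum that defines `capacity` is a maximum. -/
theorem isGreatest_capacity {θ : ℝ} (h0 : 0 ≤ θ) (h1 : θ < 1) :
    IsGreatest (capacityTerm θ '' Set.Ioi 0) (capacity θ) := by
  have hl2 : 0 < Real.log 2 := Real.log_pos (by norm_num)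
  have hhc : Continuous h := Real.binEntropy_continuous.div_const _
  have hec : Continuous fun ν : ℝ => h (Real.exp (-ν)) := hhc.comp (by fun_prop)
  have hcont : Continuous (capacityTerm θ) := by
    unfold capacityTerm
    split_ifs
    · exact hec
    · exact Continuous.min (by fun_prop) hec
  have hle : ∀ ν, capacityTerm θ ν ≤ h (Real.exp (-ν)) := by
    intro ν
    unfold capacityTerm
    split_ifs
    · exact le_rfl
    · exact min_le_right _ _
  have hh1 : 0 < h (Real.exp (-1)) :=
    div_pos (Real.binEntropy_pos (Real.exp_pos _) (by simp)) hl2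
  have hpos : 0 < capacityTerm θ 1 := by
    unfold capacityTerm
    split_ifs with hz
    · exact hh1
    · have : 0 < θ := lt_of_le_of_ne h0 (Ne.symm hz)
      have h2 : 0 < 1 - θ := by linarith
      exact lt_min (by positivity) hh1
  have hlim : Tendsto (fun ν : ℝ => h (Real.exp (-ν))) atTop (𝓝 0) := by
    have ht : Tendsto (fun ν : ℝ => Real.exp (-ν)) atTop (𝓝 0) :=
      Real.tendsto_exp_neg_atTop_nhds_zero
    have := (hhc.tendsto 0).comp ht
    simpa [h, Function.comp_def] using this
  have hev : ∀ᶠ ν in cocompact ℝ ⊓ 𝓟 (Set.Ici 0), capacityTerm θ ν ≤ capacityTerm θ 1 := by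
    have hA : ∀ᶠ ν in (atTop : Filter ℝ), capacityTerm θ ν ≤ capacityTerm θ 1 := by
      filter_upwards [hlim.eventually (gt_mem_nhds hpos)] with ν hν
      exact (hle ν).trans hν.le
    rw [cocompact_eq_atBot_atTop, inf_sup_right, eventually_sup]
    constructor
    · rw [eventually_inf_principal]
      filter_upwards [eventually_lt_atBot (0 : ℝ)] with ν hν hν'
      exact absurd (Set.mem_Ici.1 hν') (not_le.2 hν)
    · exact hA.filter_mono inf_le_left
  obtain ⟨x, hx, hmax⟩ := hcont.continuousOn.exists_isMaxOn' isClosed_Ici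
    (show (1 : ℝ) ∈ Set.Ici (0 : ℝ) by simp) hev
  have hx1 : 0 < capacityTerm θ x :=
    hpos.trans_le (hmax (show (1 : ℝ) ∈ Set.Ici (0 : ℝ) by simp))
  have hx0 : 0 < x := by
    refine lt_of_le_of_ne hx ?_
    rintro rfl
    have := hle 0
    simp [h] at this
    linarith
  have hg : IsGreatest (capacityTerm θ '' Set.Ioi 0) (capacityTerm θ x) := by
    refine ⟨⟨x, hx0, rfl⟩, ?_⟩
    rintro _ ⟨ν, hν, rfl⟩
    exact hmax (Set.mem_Ici.2 (le_of_lt hν))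
  have : capacity θ = capacityTerm θ x := hg.csSup_eq
  rwa [this]

end GroupTesting

end

namespace GroupTesting

/-! Achievability. Take p = 1 - e^{-ν/k}, so that m items are all missed by a test with probability
exactly e^{-νm/k}. If SSS errs, either a defective is masked (never the only defective in a test),
or l ≥ 1 defectives can be exchanged for l non-defectives without changing the outcomes
(`IsSSS.exists_of_ne`). Masking is unlikely when R is below the first term of C(θ). Exchanges are
handled by a Gallager-type bound with exponent s (`designExp_exists_swap_le`). For l/k small, the
same masking condition gives a geometric series in l (`exists_small_swap`). For l/k bounded below,
the bound is governed by the entropy of a test given the k - l retained defectives. Concavity of e^x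
H(e^{-x}) makes this at least l/k times the full entropy (`mul_binEntropy_le`), so R < h(e^{-ν})
suffices (`exists_large_swap`).

Converse. For given p put ν = -k log(1 - p), so that (1 - p)^k = e^{-ν}. If R > C(θ), one of the two
terms at ν is at most C(θ) < R. If it is the entropy, the T outcomes cannot carry log₂ (n choose k)
bits and the success probability tends to 0 (`exists_success_le`). If it is the masking term, the
second moment method yields a masked defective and a non-defective absent from all negative tests.
Swapping them gives another set of size k with the same outcomes, and any detector errs on half of
such ambiguous sets (`eventually_quarter_le_errorProb`). For each large n one obstruction applies,
so no limit of ν along a subsequence is needed. -/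

/-- The indicator that the column `c` (the composition of one test) misses the set `A`. -/
noncomputable def missInd {n : ℕ} (A : Finset (Fin n)) (c : Fin n → Bool) : ℝ :=
  if ∃ i ∈ A, c i = true then 0 else 1

/-- Expectation over the composition of a single Bernoulli(`p`) test. -/
noncomputable def colExp {n : ℕ} (p : ℝ) (f : (Fin n → Bool) → ℝ) : ℝ :=
  ∑ c, (∏ i, if c i = true then p else 1 - p) * f c

/-- Expectation over a Bernoulli(`p`) design. -/
noncomputable def designExp {n T : ℕ} (p : ℝ) (F : Design n T → ℝ) : ℝ :=
  ∑ X, designProb p X * F X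

open Classical in
/-- The indicator of a proposition. -/
noncomputable def ind (P : Prop) : ℝ := if P then 1 else 0

theorem ind_of_true {P : Prop} (h : P) : ind P = 1 := if_pos h

theorem ind_of_false {P : Prop} (h : ¬ P) : ind P = 0 := if_neg h

theorem ind_nonneg (P : Prop) : 0 ≤ ind P := by unfold ind; split_ifs <;> norm_num

theorem ind_le_one (P : Prop) : ind P ≤ 1 := by unfold ind; split_ifs <;> norm_num

theorem ind_mono {P Q : Prop} (h : P → Q) : ind P ≤ ind Q := by
  by_cases hP : P
  · rw [ind_of_true hP, ind_of_true (h hP)]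
  · rw [ind_of_false hP]; exact ind_nonneg Q

theorem ind_or_le (P Q : Prop) : ind (P ∨ Q) ≤ ind P + ind Q := by
  by_cases hP : P <;> by_cases hQ : Q <;> simp [ind, hP, hQ]

theorem ind_and (P Q : Prop) : ind (P ∧ Q) = ind P * ind Q := by
  by_cases hP : P <;> by_cases hQ : Q <;> simp [ind, hP, hQ]

theorem ind_not (P : Prop) : ind (¬ P) = 1 - ind P := by
  by_cases hP : P <;> simp [ind, hP]

theorem ind_exists_le_sum {ι : Type*} (s : Finset ι) (P : ι → Prop) :
    ind (∃ i ∈ s, P i) ≤ ∑ i ∈ s, ind (P i) := by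
  by_cases h : ∃ i ∈ s, P i
  · rw [ind_of_true h]
    obtain ⟨i, hi, hP⟩ := h
    rw [← ind_of_true hP]
    exact Finset.single_le_sum (f := fun i => ind (P i)) (fun j _ => ind_nonneg _) hi
  · rw [ind_of_false h]
    exact Finset.sum_nonneg fun j _ => ind_nonneg _

/-! ### Independence of tests and items, and elementary facts about outcomes. -/

section basics

variable {n T : ℕ} {p : ℝ}

/-- Independence of the tests: transposing the design turns the sum over designs into a sum over
families of columns, which expands the product of sums. -/
theorem designExp_prod (p : ℝ) (f : Fin T → (Fin n → Bool) → ℝ) :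
    designExp p (fun X => ∏ t, f t (fun i => X i t)) = ∏ t, colExp p (f t) := by
  unfold designExp colExp
  rw [Finset.prod_univ_sum, Fintype.piFinset_univ]
  refine Fintype.sum_equiv (Equiv.piComm fun _ _ => Bool) _ _ fun X => ?_
  unfold designProb
  rw [Finset.prod_comm, ← Finset.prod_mul_distrib]
  rfl

theorem missInd_eq_prod (A : Finset (Fin n)) (c : Fin n → Bool) :
    missInd A c = ∏ i, if i ∈ A ∧ c i = true then 0 else 1 := by
  unfold missInd
  split_ifs with h
  · obtain ⟨i, hi, hc⟩ := h
    exact (Finset.prod_eq_zero (Finset.mem_univ i) (by simp [hi, hc])).symm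
  · push Not at h
    exact (Finset.prod_eq_one fun i _ => if_neg fun hh => h i hh.1 hh.2).symm

theorem colExp_missInd (p : ℝ) (A : Finset (Fin n)) :
    colExp p (missInd A) = (1 - p) ^ A.card := by
  have h := Finset.prod_univ_sum (fun _ : Fin n => (Finset.univ : Finset Bool))
    (fun i b => (if b = true then p else 1 - p) * if i ∈ A ∧ b = true then (0 : ℝ) else 1)
  rw [Fintype.piFinset_univ] at h
  unfold colExp
  simp_rw [missInd_eq_prod, ← Finset.prod_mul_distrib]
  rw [← h, ← Finset.prod_const, ← Finset.prod_subset (Finset.subset_univ A)]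
  · refine Finset.prod_congr rfl fun i hi => ?_
    simp [hi]
  · intro i _ hi
    simp [hi]

theorem colExp_one (p : ℝ) : colExp (n := n) p (fun _ => 1) = 1 := by
  have := colExp_missInd (n := n) p ∅
  have he : (missInd ∅ : (Fin n → Bool) → ℝ) = fun _ => 1 := by
    funext c; simp [missInd]
  simpa [he] using this

theorem colExp_add (f g : (Fin n → Bool) → ℝ) :
    colExp p (fun c => f c + g c) = colExp p f + colExp p g := by
  simp only [colExp, mul_add, Finset.sum_add_distrib]

theorem colExp_sub (f g : (Fin n → Bool) → ℝ) :
    colExp p (fun c => f c - g c) = colExp p f - colExp p g := by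
  simp only [colExp, mul_sub, Finset.sum_sub_distrib]

theorem colExp_mul_const (f : (Fin n → Bool) → ℝ) (a : ℝ) :
    colExp p (fun c => f c * a) = colExp p f * a := by
  simp only [colExp, Finset.sum_mul, mul_assoc]

theorem designExp_one (p : ℝ) : designExp (n := n) (T := T) p (fun _ => 1) = 1 := by
  have := designExp_prod (n := n) (T := T) p (fun _ _ => 1)
  simpa [colExp_one] using this

theorem sum_designProb (p : ℝ) : ∑ X : Design n T, designProb p X = 1 := by
  simpa [designExp] using designExp_one (n := n) (T := T) p

theorem designProb_nonneg (h0 : 0 ≤ p) (h1 : p ≤ 1) (X : Design n T) : 0 ≤ designProb p X := by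
  refine Finset.prod_nonneg fun i _ => Finset.prod_nonneg fun t _ => ?_
  split_ifs <;> linarith

theorem designExp_mono (h0 : 0 ≤ p) (h1 : p ≤ 1) {F G : Design n T → ℝ} (h : ∀ X, F X ≤ G X) :
    designExp p F ≤ designExp p G :=
  Finset.sum_le_sum fun X _ => mul_le_mul_of_nonneg_left (h X) (designProb_nonneg h0 h1 X)

theorem designExp_const (p a : ℝ) : designExp (n := n) (T := T) p (fun _ => a) = a := by
  rw [designExp, ← Finset.sum_mul, sum_designProb, one_mul]

theorem designExp_nonneg (h0 : 0 ≤ p) (h1 : p ≤ 1) {F : Design n T → ℝ} (h : ∀ X, 0 ≤ F X) :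
    0 ≤ designExp p F :=
  Finset.sum_nonneg fun X _ => mul_nonneg (designProb_nonneg h0 h1 X) (h X)

theorem designExp_add (F G : Design n T → ℝ) :
    designExp p (fun X => F X + G X) = designExp p F + designExp p G := by
  simp only [designExp, mul_add, Finset.sum_add_distrib]

theorem designExp_mul_const (F : Design n T → ℝ) (a : ℝ) :
    designExp p (fun X => F X * a) = designExp p F * a := by
  simp only [designExp, Finset.sum_mul, mul_assoc]

theorem designExp_sum {ι : Type*} (s : Finset ι) (F : ι → Design n T → ℝ) :
    designExp p (fun X => ∑ i ∈ s, F i X) = ∑ i ∈ s, designExp p (F i) := by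
  simp only [designExp, Finset.mul_sum]
  exact Finset.sum_comm

/-- The design whose rows in `K` come from `X` and whose other rows come from `X'`. -/
def mixRows (K : Finset (Fin n)) (X X' : Design n T) : Design n T :=
  fun i => if i ∈ K then X i else X' i

/-- The rows outside `K` may be resampled from an independent copy of the design. -/
theorem designExp_mixRows (p : ℝ) (K : Finset (Fin n)) (F : Design n T → ℝ) :
    designExp p (fun X => designExp p fun X' => F (mixRows K X X')) = designExp p F := by
  have key : ∑ z : Design n T × Design n T,
      designProb p z.1 * (designProb p z.2 * F (mixRows K z.1 z.2)) =
      ∑ z : Design n T × Design n T, designProb p z.1 * (designProb p z.2 * F z.1) := by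
    -- Two independent designs exchange their rows outside `K`; this involution preserves their
    -- joint probability.
    have hinv : Function.Involutive fun z : Design n T × Design n T =>
        (mixRows K z.1 z.2, mixRows K z.2 z.1) := by
      intro z
      ext i <;> simp only [mixRows] <;> split_ifs <;> rfl
    refine Fintype.sum_equiv hinv.toPerm _ _ fun z => ?_
    have : designProb p z.1 * designProb p z.2 =
        designProb p (mixRows K z.1 z.2) * designProb p (mixRows K z.2 z.1) := by
      unfold designProb
      rw [← Finset.prod_mul_distrib, ← Finset.prod_mul_distrib]
      refine Finset.prod_congr rfl fun i _ => ?_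
      by_cases hi : i ∈ K
      · simp [mixRows, hi]
      · simp [mixRows, hi, mul_comm]
    simp only [Function.Involutive.coe_toPerm, ← mul_assoc, this]
  rw [Fintype.sum_prod_type, Fintype.sum_prod_type] at key
  unfold designExp
  simp_rw [Finset.mul_sum]
  rw [key]
  refine Finset.sum_congr rfl fun X _ => ?_
  dsimp only
  rw [← Finset.mul_sum, ← Finset.sum_mul, sum_designProb, one_mul]

theorem errorProb_eq (p : ℝ) (k : ℕ) (D : Detector n T) :
    errorProb p k D = (1 / (n.choose k : ℝ)) *
      ∑ K ∈ Finset.powersetCard k (Finset.univ : Finset (Fin n)),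
        designExp p fun X => ind (D X (outcome X K) ≠ K) := by
  simp [errorProb, designExp, ind]

theorem outcome_eq_true {X : Design n T} {K : Finset (Fin n)} {t : Fin T} :
    outcome X K t = true ↔ ∃ i ∈ K, X i t = true := by
  simp [outcome]

theorem outcome_eq_iff {X : Design n T} {K L : Finset (Fin n)} :
    outcome X K = outcome X L ↔
      ∀ t, (∃ i ∈ K, X i t = true) ↔ ∃ i ∈ L, X i t = true := by
  rw [funext_iff]
  refine forall_congr' fun t => ?_
  rw [Bool.eq_iff_iff, outcome_eq_true, outcome_eq_true]

/-- Outcomes are monotone in the set. This sandwich argument serves to pad small satisfying sets to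
size k and to swap items in the converse. -/
theorem outcome_eq_of_subset {X : Design n T} {A B C : Finset (Fin n)} (hAB : A ⊆ B) (hBC : B ⊆ C)
    (h : outcome X A = outcome X C) : outcome X B = outcome X C := by
  rw [outcome_eq_iff] at h ⊢
  refine fun t => ⟨fun ⟨i, hi, hx⟩ => ⟨i, hBC hi, hx⟩, fun hc => ?_⟩
  obtain ⟨i, hi, hx⟩ := (h t).2 hc
  exact ⟨i, hAB hi, hx⟩

theorem outcome_union_eq {X : Design n T} {A B : Finset (Fin n)}
    (h : outcome X A = outcome X B) : outcome X (A ∪ B) = outcome X B := by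
  rw [outcome_eq_iff] at h ⊢
  intro t
  simp only [Finset.mem_union, or_and_right, exists_or, h t, or_self]

theorem prod_ind {ι : Type*} [Fintype ι] (P : ι → Prop) : ∏ i, ind (P i) = ind (∀ i, P i) := by
  by_cases h : ∀ i, P i
  · rw [ind_of_true h]
    exact Finset.prod_eq_one fun i _ => ind_of_true (h i)
  · rw [ind_of_false h]
    push Not at h
    obtain ⟨i, hi⟩ := h
    exact Finset.prod_eq_zero (Finset.mem_univ i) (ind_of_false hi)

/-- The tests are independent and identically distributed. -/
theorem designExp_ind_forall (p : ℝ) (P : (Fin n → Bool) → Prop) :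
    designExp (T := T) p (fun X => ind (∀ t, P fun i => X i t)) =
      (colExp p fun c => ind (P c)) ^ T := by
  have h := designExp_prod (n := n) (T := T) p (fun _ c => ind (P c))
  rw [Finset.prod_const, Finset.card_univ, Fintype.card_fin] at h
  rw [← h]
  simp_rw [prod_ind]

theorem missInd_eq_ind (A : Finset (Fin n)) (c : Fin n → Bool) :
    missInd A c = ind (¬ ∃ i ∈ A, c i = true) := by
  unfold missInd ind; split_ifs <;> simp_all

/-- Law of the event that a smaller set has the same outcomes. -/
theorem designExp_outcome_eq_subset (p : ℝ) {A B : Finset (Fin n)} (hAB : A ⊆ B) :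
    designExp (T := T) p (fun X => ind (outcome X A = outcome X B)) =
      (1 - ((1 - p) ^ A.card - (1 - p) ^ B.card)) ^ T := by
  simp_rw [outcome_eq_iff]
  -- A test separates `A` from `B` exactly when it misses `A` and hits `B`, an event with indicator
  -- `missInd A - missInd B`.
  rw [designExp_ind_forall p fun c => (∃ i ∈ A, c i = true) ↔ ∃ i ∈ B, c i = true,
    ← colExp_missInd, ← colExp_missInd, ← colExp_sub, ← colExp_one (n := n) p, ← colExp_sub]
  congr 2
  funext c
  by_cases hA : ∃ i ∈ A, c i = true
  · have hB : ∃ i ∈ B, c i = true := by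
      obtain ⟨i, hi, hx⟩ := hA; exact ⟨i, hAB hi, hx⟩
    simp [missInd, ind, hA, hB]
  · by_cases hB : ∃ i ∈ B, c i = true
    · simp [missInd, ind, hA, hB]
    · simp [missInd, ind, hA, hB]

end basics

/-! ### The union and random coding bounds for SSS, at finite n. -/

section achievability

variable {n T : ℕ} {p : ℝ}

theorem missInd_of_true {A : Finset (Fin n)} {c : Fin n → Bool} (h : ∃ i ∈ A, c i = true) :
    missInd A c = 0 := if_pos h

theorem missInd_of_false {A : Finset (Fin n)} {c : Fin n → Bool} (h : ¬ ∃ i ∈ A, c i = true) :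
    missInd A c = 1 := if_neg h

/-- The probability, over the rows of a set `M` disjoint from the defective set, that a given test
is consistent with the set `A ∪ M`. -/
noncomputable def consistProb (A K : Finset (Fin n)) (u : ℝ) (c : Fin n → Bool) : ℝ :=
  1 - missInd A c + missInd K c * u + (missInd A c - missInd K c) * (1 - u)

/-- Three kinds of test: one hitting `A` is always consistent; one missing `K` must miss `M` too;
one hitting `K` only outside `A` must hit `M`. The kinds are disjoint, so powers of `consistProb`
have explicit means. -/
theorem consistProb_eq {A K : Finset (Fin n)} (hAK : A ⊆ K) (u : ℝ) (c : Fin n → Bool) :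
    consistProb A K u c = 1 ∧ (missInd A c = 0 ∧ missInd K c = 0) ∨
    consistProb A K u c = u ∧ (missInd A c = 1 ∧ missInd K c = 1) ∨
    consistProb A K u c = 1 - u ∧ (missInd A c = 1 ∧ missInd K c = 0) := by
  by_cases hA : ∃ i ∈ A, c i = true
  · have hK : ∃ i ∈ K, c i = true := by
      obtain ⟨i, hi, hx⟩ := hA; exact ⟨i, hAK hi, hx⟩
    simp [consistProb, missInd_of_true hA, missInd_of_true hK]
  · by_cases hK : ∃ i ∈ K, c i = true
    · simp [consistProb, missInd_of_false hA, missInd_of_true hK]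
    · simp [consistProb, missInd_of_false hA, missInd_of_false hK]

theorem colExp_consistProb_rpow {A K : Finset (Fin n)} (hAK : A ⊆ K) (u s : ℝ) :
    colExp p (fun c => consistProb A K u c ^ s) =
      1 - (1 - p) ^ A.card + (1 - p) ^ K.card * u ^ s +
        ((1 - p) ^ A.card - (1 - p) ^ K.card) * (1 - u) ^ s := by
  have : (fun c => consistProb A K u c ^ s) = fun c =>
      (1 - missInd A c + missInd K c * u ^ s) + (missInd A c - missInd K c) * (1 - u) ^ s := by
    funext c
    rcases consistProb_eq hAK u c with ⟨h, h1, h2⟩ | ⟨h, h1, h2⟩ | ⟨h, h1, h2⟩ <;>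
      simp [h, h1, h2]
  rw [this, colExp_add, colExp_add, colExp_sub, colExp_mul_const, colExp_mul_const, colExp_sub,
    colExp_one, colExp_missInd, colExp_missInd]

/-- With the rows of `K` fixed, the rows of `M` are fresh, so the tests remain independent and each
contributes its own conditional probability. -/
theorem designExp_consistent_mixRows (p : ℝ) {A K M : Finset (Fin n)} (hAK : A ⊆ K)
    (hM : Disjoint K M) (X : Design n T) :
    designExp p (fun X' => ind (outcome (mixRows K X X') (A ∪ M) = outcome (mixRows K X X') K)) =
      ∏ t, consistProb A K ((1 - p) ^ M.card) (fun i => X i t) := by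
  let g : Fin T → (Fin n → Bool) → ℝ := fun t c =>
    1 - missInd A (fun i => X i t) + missInd M c * missInd K (fun i => X i t) +
      (1 - missInd M c) * (missInd A (fun i => X i t) - missInd K (fun i => X i t))
  have hg : ∀ t, colExp p (g t) = consistProb A K ((1 - p) ^ M.card) (fun i => X i t) := by
    intro t
    have h1 := colExp_mul_const (p := p) (fun _ : Fin n → Bool => (1 : ℝ))
      (1 - missInd A (fun i => X i t))
    simp only [one_mul, colExp_one] at h1
    have h2 : g t = fun c => ((1 - missInd A (fun i => X i t)) +
        missInd M c * missInd K (fun i => X i t)) +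
        (1 - missInd M c) * (missInd A (fun i => X i t) - missInd K (fun i => X i t)) := rfl
    rw [h2, colExp_add, colExp_add, colExp_mul_const, colExp_mul_const, h1, colExp_sub, colExp_one,
      colExp_missInd, consistProb]
    ring
  simp_rw [← hg, ← designExp_prod, outcome_eq_iff, ← prod_ind]
  congr 1
  funext X'
  refine Finset.prod_congr rfl fun t _ => ?_
  have hKe : (∃ i ∈ K, mixRows K X X' i t = true) ↔ ∃ i ∈ K, X i t = true := by
    refine exists_congr fun i => and_congr_right fun hi => ?_
    simp [mixRows, hi]
  have hAe : (∃ i ∈ A, mixRows K X X' i t = true) ↔ ∃ i ∈ A, X i t = true := by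
    refine exists_congr fun i => and_congr_right fun hi => ?_
    simp [mixRows, hAK hi]
  have hMe : (∃ i ∈ M, mixRows K X X' i t = true) ↔ ∃ i ∈ M, X' i t = true := by
    refine exists_congr fun i => and_congr_right fun hi => ?_
    simp [mixRows, Finset.disjoint_right.1 hM hi]
  simp only [Finset.mem_union, or_and_right, exists_or, hKe, hAe, hMe, g]
  by_cases hA : ∃ i ∈ A, X i t = true
  · have hK : ∃ i ∈ K, X i t = true := by
      obtain ⟨i, hi, hx⟩ := hA; exact ⟨i, hAK hi, hx⟩
    simp [missInd, ind, hA, hK]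
  · by_cases hK : ∃ i ∈ K, X i t = true <;> by_cases hMM : ∃ i ∈ M, X' i t = true <;>
      simp [missInd, ind, hA, hK, hMM]

/-- Gallager's step: a probability x with union bound y satisfies x ≤ min(1, y) ≤ y^s. -/
theorem le_rpow_of_le_one {x y s : ℝ} (hx : 0 ≤ x) (hx1 : x ≤ 1) (hxy : x ≤ y) (hs0 : 0 ≤ s)
    (hs1 : s ≤ 1) : x ≤ y ^ s := by
  rcases hx.eq_or_lt with h | h
  · rw [← h] at hxy ⊢
    exact Real.rpow_nonneg hxy s
  · calc x = x ^ (1 : ℝ) := (Real.rpow_one x).symm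
      _ ≤ x ^ s := Real.rpow_le_rpow_of_exponent_ge h hx1 hs1
      _ ≤ y ^ s := Real.rpow_le_rpow hx hxy hs0

/-- The random coding bound for exchanging the defectives outside `A` for `l` non-defectives. -/
theorem designExp_exists_swap_le (h0 : 0 ≤ p) (h1 : p ≤ 1) {A K : Finset (Fin n)} (hAK : A ⊆ K)
    (l : ℕ) {s : ℝ} (hs0 : 0 ≤ s) (hs1 : s ≤ 1) :
    designExp (T := T) p
        (fun X => ind (∃ M ∈ Finset.powersetCard l Kᶜ, outcome X (A ∪ M) = outcome X K)) ≤
      ((n - K.card).choose l : ℝ) ^ s * (1 - (1 - p) ^ A.card +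
        (1 - p) ^ K.card * ((1 - p) ^ l) ^ s +
        ((1 - p) ^ A.card - (1 - p) ^ K.card) * (1 - (1 - p) ^ l) ^ s) ^ T := by
  have hp0 : (0 : ℝ) ≤ 1 - p := by linarith
  have hu0 : 0 ≤ (1 - p) ^ l := pow_nonneg hp0 l
  have hu1 : (1 - p) ^ l ≤ 1 := pow_le_one₀ hp0 (by linarith)
  have hc0 : ∀ c, 0 ≤ consistProb A K ((1 - p) ^ l) c := by
    intro c
    rcases consistProb_eq hAK ((1 - p) ^ l) c with ⟨h, -⟩ | ⟨h, -⟩ | ⟨h, -⟩ <;> rw [h] <;> linarith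
  -- Condition on the rows of `K`: the union bound over `M` is raised to the power s inside, and
  -- only then averaged over these rows.
  rw [← colExp_consistProb_rpow hAK, ← designExp_mixRows p K]
  have hR : ((n - K.card).choose l : ℝ) ^ s *
      (colExp p fun c => consistProb A K ((1 - p) ^ l) c ^ s) ^ T =
      designExp (T := T) p (fun X => (∏ t, consistProb A K ((1 - p) ^ l) (fun i => X i t) ^ s) *
        ((n - K.card).choose l : ℝ) ^ s) := by
    rw [designExp_mul_const,
      designExp_prod p (fun _ c => consistProb A K ((1 - p) ^ l) c ^ s), Finset.prod_const,
      Finset.card_univ, Fintype.card_fin, mul_comm]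
  rw [hR]
  refine designExp_mono h0 h1 fun X => ?_
  rw [Real.finsetProd_rpow _ _ fun t _ => hc0 _, ← Real.mul_rpow (Finset.prod_nonneg fun t _ => hc0 _)
    (Nat.cast_nonneg _)]
  refine le_rpow_of_le_one (designExp_nonneg h0 h1 fun X' => ind_nonneg _) ?_ ?_ hs0 hs1
  · rw [← designExp_one (n := n) (T := T) p]
    exact designExp_mono h0 h1 fun X' => ind_le_one _
  · refine (designExp_mono h0 h1 fun X' => ind_exists_le_sum _ _).trans ?_
    rw [designExp_sum]
    have : ∀ M ∈ Finset.powersetCard l Kᶜ, designExp p (fun X' => ind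
        (outcome (mixRows K X X') (A ∪ M) = outcome (mixRows K X X') K)) =
        ∏ t, consistProb A K ((1 - p) ^ l) (fun i => X i t) := by
      intro M hM
      rw [Finset.mem_powersetCard] at hM
      rw [designExp_consistent_mixRows p hAK
        (Finset.disjoint_left.2 fun i hi hiM => (Finset.mem_compl.1 (hM.1 hiM)) hi), hM.2]
    rw [Finset.sum_congr rfl this, Finset.sum_const, Finset.card_powersetCard, Finset.card_compl,
      Fintype.card_fin, nsmul_eq_mul, mul_comm]

/-- When the smallest satisfying set is not the defective set, either a defective item is masked
by the others or exchanging some of the defectives gives the same outcomes. -/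
theorem IsSSS.exists_of_ne {D : Detector n T} (hD : IsSSS D) {X : Design n T} {K : Finset (Fin n)}
    (h : D X (outcome X K) ≠ K) :
    (∃ i ∈ K, outcome X (K.erase i) = outcome X K) ∨
    ∃ l ∈ Finset.Icc 1 K.card, ∃ J ∈ Finset.powersetCard l K,
      ∃ M ∈ Finset.powersetCard l Kᶜ, outcome X ((K \ J) ∪ M) = outcome X K := by
  obtain ⟨hL, hmin⟩ := hD X (outcome X K) ⟨K, rfl⟩
  have hcard := hmin K rfl
  set L := D X (outcome X K)
  unfold IsSatisfying at hL
  by_cases hLK : L ⊆ K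
  · left
    obtain ⟨i, hi⟩ : ∃ i ∈ K, i ∉ L := by
      by_contra! hc
      exact h (hLK.antisymm hc)
    exact ⟨i, hi.1, outcome_eq_of_subset (fun j hj => Finset.mem_erase.2
      ⟨fun hji => hi.2 (hji ▸ hj), hLK hj⟩) (Finset.erase_subset i K) hL⟩
  · right
    -- `L` may be smaller than `K`, so it is padded to the size of `K` inside `L ∪ K`. That union
    -- has the outcomes of `K`, hence so does every set between `L` and it.
    obtain ⟨L', hLL', hL'K, hc⟩ := Finset.exists_subsuperset_card_eq
      (Finset.subset_union_left (s₁ := L) (s₂ := K)) hcard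
      (Finset.card_le_card Finset.subset_union_right)
    have hout : outcome X L' = outcome X K := by
      have hu := outcome_union_eq hL
      rw [outcome_eq_of_subset hLL' hL'K (hL.trans hu.symm), hu]
    have hM : (L' \ K).card = (K \ L').card := Finset.card_sdiff_comm hc
    refine ⟨(K \ L').card, Finset.mem_Icc.2 ⟨?_, Finset.card_le_card Finset.sdiff_subset⟩, K \ L',
      Finset.mem_powersetCard.2 ⟨Finset.sdiff_subset, rfl⟩, L' \ K,
      Finset.mem_powersetCard.2 ⟨fun i hi => ?_, hM⟩, ?_⟩
    · rw [← hM, Nat.one_le_iff_ne_zero, Finset.card_ne_zero]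
      obtain ⟨i, hi, hiK⟩ := Finset.not_subset.1 hLK
      exact ⟨i, Finset.mem_sdiff.2 ⟨hLL' hi, hiK⟩⟩
    · exact Finset.mem_compl.2 (Finset.mem_sdiff.1 hi).2
    · rw [← hout]
      congr 1
      ext i
      simp only [Finset.mem_union, Finset.mem_sdiff]
      tauto

/-- The random coding bound for the probability that exchanging `l` of the `k` defectives for
non-defectives gives the same outcomes. -/
noncomputable def swapBound (n T k : ℕ) (p : ℝ) (l : ℕ) (s : ℝ) : ℝ :=
  (k.choose l : ℝ) * (((n - k).choose l : ℝ) ^ s * (1 - (1 - p) ^ (k - l) +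
    (1 - p) ^ k * ((1 - p) ^ l) ^ s + ((1 - p) ^ (k - l) - (1 - p) ^ k) * (1 - (1 - p) ^ l) ^ s) ^ T)

/-- The exponent may depend on l because few and many exchanges call for different values. -/
theorem IsSSS.errorProb_le {D : Detector n T} (hD : IsSSS D) (h0 : 0 ≤ p) (h1 : p ≤ 1) {k : ℕ}
    (hkn : k ≤ n) {s : ℕ → ℝ} (hs0 : ∀ l, 0 ≤ s l) (hs1 : ∀ l, s l ≤ 1) :
    errorProb p k D ≤ k * (1 - ((1 - p) ^ (k - 1) - (1 - p) ^ k)) ^ T +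
      ∑ l ∈ Finset.Icc 1 k, swapBound n T k p l (s l) := by
  set B := k * (1 - ((1 - p) ^ (k - 1) - (1 - p) ^ k)) ^ T +
      ∑ l ∈ Finset.Icc 1 k, swapBound n T k p l (s l)
  have key : ∀ K ∈ Finset.powersetCard k (Finset.univ : Finset (Fin n)),
      designExp p (fun X => ind (D X (outcome X K) ≠ K)) ≤ B := by
    intro K hK
    have hKc : K.card = k := (Finset.mem_powersetCard.1 hK).2
    calc designExp p (fun X => ind (D X (outcome X K) ≠ K))
        ≤ designExp p (fun X => (∑ i ∈ K, ind (outcome X (K.erase i) = outcome X K)) +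
          ∑ l ∈ Finset.Icc 1 k, ∑ J ∈ Finset.powersetCard l K,
            ind (∃ M ∈ Finset.powersetCard l Kᶜ, outcome X ((K \ J) ∪ M) = outcome X K)) := by
          refine designExp_mono h0 h1 fun X => ?_
          refine (ind_mono hD.exists_of_ne).trans ((ind_or_le _ _).trans (add_le_add
            (ind_exists_le_sum _ _) ?_))
          rw [hKc]
          exact (ind_exists_le_sum _ _).trans (Finset.sum_le_sum fun l _ => ind_exists_le_sum _ _)
      _ ≤ B := by
          rw [designExp_add, designExp_sum, designExp_sum]
          refine add_le_add (le_of_eq ?_) (Finset.sum_le_sum fun l hl => ?_)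
          · rw [Finset.sum_congr rfl fun i hi => ?_, Finset.sum_const, hKc, nsmul_eq_mul]
            rw [designExp_outcome_eq_subset p (Finset.erase_subset i K), Finset.card_erase_of_mem hi,
              hKc]
          · rw [designExp_sum]
            refine (Finset.sum_le_sum (g := fun _ => swapBound n T k p l (s l) / k.choose l)
              fun J hJ => ?_).trans (le_of_eq ?_)
            · rw [Finset.mem_powersetCard] at hJ
              refine (designExp_exists_swap_le h0 h1 (Finset.sdiff_subset (s := K) (t := J)) l
                (hs0 l) (hs1 l)).trans (le_of_eq ?_)
              have : (k.choose l : ℝ) ≠ 0 :=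
                Nat.cast_ne_zero.2 (Nat.choose_pos (Finset.mem_Icc.1 hl).2).ne'
              rw [Finset.card_sdiff_of_subset hJ.1, hKc, hJ.2, swapBound, mul_div_cancel_left₀ _ this]
            · have : (k.choose l : ℝ) ≠ 0 :=
                Nat.cast_ne_zero.2 (Nat.choose_pos (Finset.mem_Icc.1 hl).2).ne'
              rw [Finset.sum_const, Finset.card_powersetCard, hKc, nsmul_eq_mul,
                mul_div_cancel₀ _ this]
  have hN : (0 : ℝ) < n.choose k := Nat.cast_pos.2 (Nat.choose_pos hkn)
  rw [errorProb_eq, one_div, inv_mul_le_iff₀ hN]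
  refine (Finset.sum_le_sum key).trans (le_of_eq ?_)
  rw [Finset.sum_const, Finset.card_powersetCard, Finset.card_univ, Fintype.card_fin, nsmul_eq_mul]

end achievability

/-! ### Finite-n lower bounds on the error of an arbitrary detector. -/

section converse

variable {n T : ℕ} {p : ℝ}

theorem sum_ind_le_sum_ind {α : Type*} {P : Finset α} {Q R : α → Prop} (f : α → α)
    (hf : ∀ a ∈ P, Q a → f a ∈ P ∧ R (f a))
    (hinj : ∀ a ∈ P, ∀ b ∈ P, Q a → Q b → f a = f b → a = b) :
    ∑ a ∈ P, ind (Q a) ≤ ∑ a ∈ P, ind (R a) := by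
  classical
  simp only [ind, Finset.sum_boole]
  refine Nat.cast_le.2 (Finset.card_le_card_of_injOn f ?_ ?_)
  · intro a ha
    simp only [Finset.coe_filter, Set.mem_ofPred_eq] at ha ⊢
    exact hf a ha.1 ha.2
  · intro a ha b hb
    simp only [Finset.coe_filter, Set.mem_ofPred_eq] at ha hb
    exact hinj a ha.1 b hb.1 ha.2 hb.2

/-- The probability of the outcomes `y` when every test is negative with probability `q`. -/
noncomputable def outcomeProb (q : ℝ) (y : Fin T → Bool) : ℝ := ∏ t, if y t = true then 1 - q else q

theorem sum_prod_ite (a b : ℝ) :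
    ∑ y : Fin T → Bool, ∏ t, (if y t = true then a else b) = (b + a) ^ T := by
  have h := Finset.prod_univ_sum (fun _ : Fin T => (Finset.univ : Finset Bool))
    (fun _ c => if c = true then a else b)
  rw [Fintype.piFinset_univ] at h
  rw [← h]
  simp [add_comm]

theorem outcomeProb_nonneg {q : ℝ} (h0 : 0 ≤ q) (h1 : q ≤ 1) (y : Fin T → Bool) :
    0 ≤ outcomeProb q y := by
  refine Finset.prod_nonneg fun t _ => ?_
  split_ifs <;> linarith

theorem sum_outcomeProb (q : ℝ) : ∑ y : Fin T → Bool, outcomeProb q y = 1 := by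
  simp [outcomeProb, sum_prod_ite]

theorem sum_outcomeProb_rpow {q : ℝ} (h0 : 0 ≤ q) (h1 : q ≤ 1) (r : ℝ) :
    ∑ y : Fin T → Bool, outcomeProb q y ^ r = (q ^ r + (1 - q) ^ r) ^ T := by
  rw [← sum_prod_ite]
  refine Finset.sum_congr rfl fun y _ => ?_
  rw [outcomeProb, ← Real.finsetProd_rpow _ _ fun t _ => by split_ifs <;> linarith]
  refine Finset.prod_congr rfl fun t _ => ?_
  split_ifs <;> rfl

theorem designExp_ind_outcome (p : ℝ) (K : Finset (Fin n)) (y : Fin T → Bool) :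
    designExp p (fun X => ind (outcome X K = y)) = outcomeProb ((1 - p) ^ K.card) y := by
  have h := designExp_prod p (fun t (c : Fin n → Bool) =>
    if y t = true then 1 - missInd K c else missInd K c)
  have h2 : ∀ t, (colExp p fun c : Fin n → Bool => if y t = true then 1 - missInd K c
      else missInd K c) = if y t = true then 1 - (1 - p) ^ K.card else (1 - p) ^ K.card := by
    intro t
    split_ifs
    · rw [colExp_sub, colExp_one, colExp_missInd]
    · exact colExp_missInd p K
  simp_rw [h2] at h
  rw [outcomeProb, ← h]
  congr 1
  funext X
  rw [funext_iff, ← prod_ind]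
  refine Finset.prod_congr rfl fun t _ => ?_
  by_cases hK : ∃ i ∈ K, X i t = true
  · rw [outcome_eq_true.2 hK]
    rw [missInd_of_true hK]
    cases hy : y t <;> simp [ind]
  · have hK' : outcome X K t = false := by
      rw [← Bool.not_eq_true, outcome_eq_true]; exact hK
    rw [missInd_of_false hK, hK']
    cases hy : y t <;> simp [ind]

theorem designExp_outcome (p : ℝ) (K : Finset (Fin n)) (F : (Fin T → Bool) → ℝ) :
    designExp p (fun X => F (outcome X K)) = ∑ y, outcomeProb ((1 - p) ^ K.card) y * F y := by
  simp_rw [← designExp_ind_outcome, ← designExp_mul_const, ← designExp_sum]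
  congr 1
  funext X
  rw [Finset.sum_eq_single (outcome X K)]
  · rw [ind_of_true rfl, one_mul]
  · intro y _ hy
    rw [ind_of_false fun h => hy h.symm, zero_mul]
  · exact fun h => absurd (Finset.mem_univ _) h

theorem one_sub_errorProb (hk : k ≤ n) (D : Detector n T) :
    1 - errorProb p k D = (1 / (n.choose k : ℝ)) *
      designExp p (fun X => ∑ K ∈ Finset.powersetCard k (Finset.univ : Finset (Fin n)),
        ind (D X (outcome X K) = K)) := by
  have hN : (n.choose k : ℝ) ≠ 0 := Nat.cast_ne_zero.2 (Nat.choose_pos hk).ne'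
  have h1 : ∀ K : Finset (Fin n), designExp p (fun X => ind (D X (outcome X K) ≠ K)) =
      1 - designExp p (fun X => ind (D X (outcome X K) = K)) := by
    intro K
    have := designExp_add (p := p) (fun X => ind (D X (outcome X K) ≠ K))
      (fun X => ind (D X (outcome X K) = K))
    simp only [ne_eq, ind_not, sub_add_cancel, designExp_one] at this
    simp only [ne_eq, ind_not]
    linarith
  rw [errorProb_eq, designExp_sum, Finset.sum_congr rfl fun K _ => h1 K, Finset.sum_sub_distrib,
    Finset.sum_const, Finset.card_powersetCard, Finset.card_univ, Fintype.card_fin, nsmul_eq_mul]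
  field_simp
  ring

/-- A detector succeeds with small probability when the outcomes have small entropy. -/
theorem one_sub_errorProb_le (h0 : 0 ≤ p) (h1 : p ≤ 1) {k : ℕ} (hk : k ≤ n) (D : Detector n T)
    {τ s : ℝ} (hτ : 0 < τ) (hs : 0 ≤ s) :
    1 - errorProb p k D ≤ 1 / (τ * n.choose k) +
      τ ^ s * (((1 - p) ^ k) ^ (1 - s) + (1 - (1 - p) ^ k) ^ (1 - s)) ^ T := by
  have hp0 : (0 : ℝ) ≤ 1 - p := by linarith
  set q := (1 - p) ^ k with hq
  have hq0 : 0 ≤ q := pow_nonneg hp0 k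
  have hq1 : q ≤ 1 := pow_le_one₀ hp0 (by linarith)
  have hN : (0 : ℝ) < n.choose k := Nat.cast_pos.2 (Nat.choose_pos hk)
  set P := Finset.powersetCard k (Finset.univ : Finset (Fin n))
  -- For a fixed design, correctly decoded sets have distinct outcomes. Since `outcomeProb` sums to
  -- 1, at most 1/τ of them have outcomes of probability at least τ.
  have hfix : ∀ X : Design n T, ∑ K ∈ P, ind (D X (outcome X K) = K) ≤
      1 / τ + ∑ K ∈ P, ind (outcomeProb q (outcome X K) < τ) := by
    intro X
    have hsplit : ∀ K ∈ P, ind (D X (outcome X K) = K) ≤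
        ind (D X (outcome X K) = K ∧ τ ≤ outcomeProb q (outcome X K)) +
          ind (outcomeProb q (outcome X K) < τ) := by
      intro K _
      refine (ind_mono fun h => ?_).trans (ind_or_le _ _)
      rcases le_or_gt τ (outcomeProb q (outcome X K)) with h' | h'
      · exact Or.inl ⟨h, h'⟩
      · exact Or.inr h'
    refine (Finset.sum_le_sum hsplit).trans ?_
    rw [Finset.sum_add_distrib]
    refine add_le_add_left ?_ _
    classical
    have hsum : ∑ K ∈ P, ind (D X (outcome X K) = K ∧ τ ≤ outcomeProb q (outcome X K)) ≤
        ∑ K ∈ P.filter (fun K => D X (outcome X K) = K),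
          outcomeProb q (outcome X K) / τ := by
      rw [Finset.sum_filter]
      refine Finset.sum_le_sum fun K _ => ?_
      have hnn := div_nonneg (outcomeProb_nonneg hq0 hq1 (outcome X K)) hτ.le
      by_cases hD : D X (outcome X K) = K
      · rw [if_pos hD]
        by_cases hg : τ ≤ outcomeProb q (outcome X K)
        · rw [ind_of_true ⟨hD, hg⟩]
          exact (one_le_div hτ).2 hg
        · rw [ind_of_false fun h => hg h.2]
          exact hnn
      · rw [if_neg hD, ind_of_false fun h => hD h.1]
    refine hsum.trans ?_
    rw [← Finset.sum_image (f := fun y => outcomeProb q y / τ) (g := outcome X), one_div]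
    · refine (Finset.sum_le_univ_sum_of_nonneg fun y =>
        div_nonneg (outcomeProb_nonneg hq0 hq1 y) hτ.le).trans ?_
      rw [← Finset.sum_div, sum_outcomeProb, one_div]
    · intro K hK L hL hKL
      simp only [Finset.coe_filter, Set.mem_ofPred_eq] at hK hL
      rw [← hK.2, ← hL.2, hKL]
  -- Chernoff bound: P < τ gives P ≤ τ^s P^{1-s}, and the sum of P^{1-s} factors over tests.
  have htail : ∀ K ∈ P, designExp (T := T) p (fun X => ind (outcomeProb q (outcome X K) < τ)) ≤
      τ ^ s * (q ^ (1 - s) + (1 - q) ^ (1 - s)) ^ T := by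
    intro K hK
    rw [designExp_outcome p K fun y => ind (outcomeProb q y < τ), (Finset.mem_powersetCard.1 hK).2,
      ← hq, ← sum_outcomeProb_rpow hq0 hq1, Finset.mul_sum]
    refine Finset.sum_le_sum fun y _ => ?_
    have hnn := outcomeProb_nonneg hq0 hq1 y
    by_cases hg : outcomeProb q y < τ
    · rw [ind_of_true hg, mul_one]
      rcases hnn.eq_or_lt with h | h
      · rw [← h]; positivity
      · calc outcomeProb q y = outcomeProb q y ^ s * outcomeProb q y ^ (1 - s) := by
              rw [← Real.rpow_add h]; simp
          _ ≤ τ ^ s * outcomeProb q y ^ (1 - s) := by gcongr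
    · rw [ind_of_false hg, mul_zero]
      positivity
  rw [one_sub_errorProb hk, one_div, inv_mul_le_iff₀ hN]
  refine (designExp_mono h0 h1 hfix).trans ?_
  rw [designExp_add, designExp_const, designExp_sum]
  refine (add_le_add_right (Finset.sum_le_sum htail) _).trans (le_of_eq ?_)
  rw [Finset.sum_const, Finset.card_powersetCard, Finset.card_univ, Fintype.card_fin, nsmul_eq_mul]
  field_simp

/-- Any detector errs on at least half of the ambiguous defective sets. -/
theorem half_le_errorProb (h0 : 0 ≤ p) (h1 : p ≤ 1) {k : ℕ} (hk : k ≤ n) (D : Detector n T) {B : ℝ}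
    (hB : ∀ K : Finset (Fin n), K.card = k → B ≤ designExp (T := T) p
      (fun X => ind (∃ L : Finset (Fin n), L.card = k ∧ L ≠ K ∧ outcome X L = outcome X K))) :
    B / 2 ≤ errorProb p k D := by
  have hN : (0 : ℝ) < n.choose k := Nat.cast_pos.2 (Nat.choose_pos hk)
  set P := Finset.powersetCard k (Finset.univ : Finset (Fin n)) with hP
  have hmem : ∀ K, K ∈ P ↔ K.card = k := fun K => by simp [hP, Finset.mem_powersetCard]
  let amb : Design n T → Finset (Fin n) → Prop := fun X K =>
    ∃ L : Finset (Fin n), L.card = k ∧ L ≠ K ∧ outcome X L = outcome X K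
  have hfix : ∀ X : Design n T, ∑ K ∈ P, ind (amb X K) ≤
      (∑ K ∈ P, ind (D X (outcome X K) ≠ K)) * 2 := by
    intro X
    -- Send a correctly decoded ambiguous set to a partner with the same outcomes. The partner is
    -- decoded wrongly, and decoding its outcomes returns the original set, so the map is injective.
    have hinj : ∑ K ∈ P, ind (amb X K ∧ D X (outcome X K) = K) ≤
        ∑ K ∈ P, ind (D X (outcome X K) ≠ K) := by
      have hch : ∀ K, ∃ L : Finset (Fin n), amb X K →
          L.card = k ∧ L ≠ K ∧ outcome X L = outcome X K := by
        intro K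
        by_cases h : amb X K
        · obtain ⟨L, hL⟩ := h; exact ⟨L, fun _ => hL⟩
        · exact ⟨∅, fun h' => absurd h' h⟩
      choose f hf using hch
      refine sum_ind_le_sum_ind f ?_ ?_
      · rintro K _ ⟨hK, hD⟩
        obtain ⟨hc, hne, ho⟩ := hf K hK
        refine ⟨(hmem _).2 hc, ?_⟩
        rw [ho, hD]
        exact hne.symm
      · rintro K _ L _ ⟨hK, hDK⟩ ⟨hL, hDL⟩ hKL
        rw [← hDK, ← hDL, ← (hf K hK).2.2, ← (hf L hL).2.2, hKL]
    rw [mul_two]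
    refine le_trans ?_ (add_le_add_left hinj _)
    rw [← Finset.sum_add_distrib]
    refine Finset.sum_le_sum fun K _ => (ind_mono fun h => ?_).trans (ind_or_le _ _)
    by_cases hD : D X (outcome X K) = K
    · exact Or.inl ⟨h, hD⟩
    · exact Or.inr hD
  have hsum : (n.choose k : ℝ) * B ≤
      (∑ K ∈ P, designExp (T := T) p fun X => ind (D X (outcome X K) ≠ K)) * 2 := by
    rw [← designExp_sum, ← designExp_mul_const]
    refine le_trans ?_ (designExp_mono h0 h1 hfix)
    rw [designExp_sum]
    refine le_trans (le_of_eq ?_) (Finset.sum_le_sum fun K hK => hB K ((hmem K).1 hK))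
    rw [Finset.sum_const, Finset.card_powersetCard, Finset.card_univ, Fintype.card_fin,
      nsmul_eq_mul]
  rw [errorProb_eq, one_div, le_inv_mul_iff₀ hN]
  linarith

/-- The second moment method for the event that none of finitely many events occurs. -/
theorem designExp_ind_not_exists_le (h0 : 0 ≤ p) (h1 : p ≤ 1) {ι : Type*} (I : Finset ι)
    (P : ι → Design n T → Prop) {μ S : ℝ} (hμ : 0 < μ)
    (h_mean : ∑ i ∈ I, designExp p (fun X => ind (P i X)) = μ)
    (h_sq : ∑ i ∈ I, ∑ j ∈ I, designExp p (fun X => ind (P i X ∧ P j X)) ≤ S) :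
    designExp p (fun X => ind (¬ ∃ i ∈ I, P i X)) ≤ S / μ ^ 2 - 1 := by
  -- With N the number of events that occur, the indicator of N = 0 is at most (1 - N/μ)².
  have hpt : ∀ X, ind (¬ ∃ i ∈ I, P i X) ≤
      (1 + (∑ i ∈ I, ind (P i X)) * (-2 / μ)) + (∑ i ∈ I, ∑ j ∈ I, ind (P i X ∧ P j X)) * (1 / μ ^ 2) := by
    intro X
    have hsq : (1 + (∑ i ∈ I, ind (P i X)) * (-2 / μ)) +
        (∑ i ∈ I, ∑ j ∈ I, ind (P i X ∧ P j X)) * (1 / μ ^ 2) =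
        (1 - (∑ i ∈ I, ind (P i X)) / μ) ^ 2 := by
      simp_rw [ind_and, ← Finset.sum_mul_sum]
      field_simp
      ring
    rw [hsq]
    by_cases h : ∃ i ∈ I, P i X
    · rw [ind_of_false (not_not.2 h)]; positivity
    · rw [Finset.sum_eq_zero fun i hi => ind_of_false fun hP => h ⟨i, hi, hP⟩, ind_of_true h]
      simp
  refine (designExp_mono h0 h1 hpt).trans ?_
  rw [designExp_add, designExp_add, designExp_mul_const, designExp_mul_const, designExp_sum,
    designExp_sum, designExp_const, h_mean]
  simp_rw [designExp_sum]
  have h2 : (∑ i ∈ I, ∑ j ∈ I, designExp p (fun X => ind (P i X ∧ P j X))) * (1 / μ ^ 2) ≤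
      S * (1 / μ ^ 2) := by gcongr
  have h3 : 1 + μ * (-2 / μ) = -1 := by field_simp; ring
  rw [h3]
  rw [mul_one_div] at h2
  rw [mul_one_div] at h2
  rw [mul_one_div]
  linarith

/-- A test unmasks i when i is its only defective. For i ≠ j these events are disjoint within one
test, so their probabilities add. -/
theorem designExp_two_masked (p : ℝ) {K : Finset (Fin n)} {i j : Fin n} (hi : i ∈ K) (hj : j ∈ K)
    (hij : i ≠ j) :
    designExp (T := T) p (fun X => ind (outcome X (K.erase i) = outcome X K ∧
      outcome X (K.erase j) = outcome X K)) =
      (1 - 2 * ((1 - p) ^ (K.card - 1) - (1 - p) ^ K.card)) ^ T := by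
  have h1 : ∀ X : Design n T, (outcome X (K.erase i) = outcome X K ∧
      outcome X (K.erase j) = outcome X K) ↔
      ∀ t, ((∃ a ∈ K.erase i, X a t = true) ↔ ∃ a ∈ K, X a t = true) ∧
        ((∃ a ∈ K.erase j, X a t = true) ↔ ∃ a ∈ K, X a t = true) := by
    intro X
    rw [outcome_eq_iff, outcome_eq_iff, forall_and]
  simp_rw [h1]
  rw [designExp_ind_forall p fun c => ((∃ a ∈ K.erase i, c a = true) ↔ ∃ a ∈ K, c a = true) ∧
        ((∃ a ∈ K.erase j, c a = true) ↔ ∃ a ∈ K, c a = true)]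
  have h2 : (1 : ℝ) - 2 * ((1 - p) ^ (K.card - 1) - (1 - p) ^ K.card) =
      colExp p fun c => (1 - (missInd (K.erase i) c - missInd K c)) -
        (missInd (K.erase j) c - missInd K c) := by
    rw [colExp_sub, colExp_sub, colExp_sub, colExp_sub, colExp_missInd, colExp_missInd,
      colExp_missInd, colExp_one, Finset.card_erase_of_mem hi, Finset.card_erase_of_mem hj]
    ring
  rw [h2]
  congr 2
  funext c
  have hor : (∃ a ∈ K, c a = true) ↔ (∃ a ∈ K.erase i, c a = true) ∨ ∃ a ∈ K.erase j, c a = true := by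
    constructor
    · rintro ⟨a, ha, hc⟩
      by_cases hai : a = i
      · exact Or.inr ⟨a, Finset.mem_erase.2 ⟨hai ▸ hij, ha⟩, hc⟩
      · exact Or.inl ⟨a, Finset.mem_erase.2 ⟨hai, ha⟩, hc⟩
    · rintro (⟨a, ha, hc⟩ | ⟨a, ha, hc⟩) <;> exact ⟨a, (Finset.mem_erase.1 ha).2, hc⟩
  have hK := missInd_eq_ind K c
  rw [hor] at hK
  rw [hor, hK, missInd_eq_ind, missInd_eq_ind]
  by_cases hI : ∃ a ∈ K.erase i, c a = true <;> by_cases hJ : ∃ a ∈ K.erase j, c a = true <;>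
    simp only [hI, hJ, ind] <;> norm_num

/-- Some defective item is masked unless the expected number of masked items is small. -/
theorem designExp_no_masked_le (h0 : 0 ≤ p) (h1 : p ≤ 1) {K : Finset (Fin n)} {k : ℕ}
    (hK : K.card = k) (hk : 2 ≤ k) {a : ℝ} (ha : (1 - p) ^ (k - 1) - (1 - p) ^ k = a) (ha2 : a < 1 / 2) :
    designExp (T := T) p (fun X => ind (¬ ∃ i ∈ K, outcome X (K.erase i) = outcome X K)) ≤
      1 / (k * (1 - a) ^ T) := by
  have hk0 : (0 : ℝ) < k := by positivity
  have ha1 : 0 < 1 - a := by linarith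
  have hμ : 0 < k * (1 - a) ^ T := by positivity
  have h_one : ∀ i ∈ K, designExp (T := T) p (fun X => ind (outcome X (K.erase i) = outcome X K)) =
      (1 - a) ^ T := by
    intro i hi
    rw [designExp_outcome_eq_subset p (Finset.erase_subset i K), Finset.card_erase_of_mem hi, hK, ha]
  have h := designExp_ind_not_exists_le h0 h1 K
    (fun i (X : Design n T) => outcome X (K.erase i) = outcome X K) (μ := k * (1 - a) ^ T)
    (S := k * (1 - a) ^ T + (k * (1 - a) ^ T) ^ 2) hμ ?_ ?_
  · refine h.trans (le_of_eq ?_)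
    field_simp
    ring
  · rw [Finset.sum_congr rfl h_one, Finset.sum_const, hK, nsmul_eq_mul]
  · have : ∀ i ∈ K, ∑ j ∈ K, designExp (T := T) p (fun X => ind (outcome X (K.erase i) = outcome X K ∧
        outcome X (K.erase j) = outcome X K)) ≤ (1 - a) ^ T + k * ((1 - a) ^ T) ^ 2 := by
      intro i hi
      rw [← Finset.add_sum_erase _ _ hi]
      refine add_le_add (le_of_eq ?_) ?_
      · simp only [and_self]
        exact h_one i hi
      · refine (Finset.sum_le_sum (g := fun _ => ((1 - a) ^ T) ^ 2) fun j hj => ?_).trans ?_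
        · rw [Finset.mem_erase] at hj
          -- Masking events are negatively correlated, as 1 - 2a ≤ (1 - a)²; hence the second moment
          -- is at most μ + μ².
          rw [designExp_two_masked p hi hj.2 hj.1.symm, hK, ha, ← pow_mul, mul_comm T, pow_mul]
          exact pow_le_pow_left₀ (by linarith) (by linarith [sq_nonneg a, show (1 - a) ^ 2 = 1 - 2 * a + a ^ 2 by ring]) T
        · rw [Finset.sum_const, nsmul_eq_mul]
          have : ((K.erase i).card : ℝ) ≤ k := by
            rw [← hK]; exact Nat.cast_le.2 (Finset.card_le_card (Finset.erase_subset i K))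
          gcongr
    refine (Finset.sum_le_sum this).trans (le_of_eq ?_)
    rw [Finset.sum_const, hK, nsmul_eq_mul]
    ring

/-- Some non-defective item appears in no negative test unless the expected number of such items
is small. -/
theorem designExp_no_hidden_le (h0 : 0 ≤ p) (h1 : p ≤ 1) {K : Finset (Fin n)} {k : ℕ}
    (hK : K.card = k) (hkn : k < n) {b : ℝ} (hb : p * (1 - p) ^ k = b) (hb2 : b ≤ 1 / 2) :
    designExp (T := T) p (fun X => ind (¬ ∃ j ∈ Kᶜ, outcome X K = outcome X (insert j K))) ≤
      1 / ((n - k : ℕ) * (1 - b) ^ T) + ((1 + 4 * b * p) ^ T - 1) := by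
  have hp0 : (0 : ℝ) ≤ 1 - p := by linarith
  have hb0 : 0 ≤ b := by rw [← hb]; positivity
  have hk0 : (0 : ℝ) < (n - k : ℕ) := Nat.cast_pos.2 (by omega)
  have hb1 : 0 < 1 - b := by linarith
  have hμ : 0 < (n - k : ℕ) * (1 - b) ^ T := by positivity
  have hKc : Kᶜ.card = n - k := by rw [Finset.card_compl, hK, Fintype.card_fin]
  have h_one : ∀ j ∈ Kᶜ, designExp (T := T) p (fun X => ind (outcome X K = outcome X (insert j K))) =
      (1 - b) ^ T := by
    intro j hj
    rw [designExp_outcome_eq_subset p (Finset.subset_insert j K),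
      Finset.card_insert_of_notMem (Finset.mem_compl.1 hj), hK, ← hb]
    ring
  have h := designExp_ind_not_exists_le h0 h1 Kᶜ
    (fun j (X : Design n T) => outcome X K = outcome X (insert j K))
    (μ := (n - k : ℕ) * (1 - b) ^ T)
    (S := (n - k : ℕ) * (1 - b) ^ T + ((n - k : ℕ) * (1 - b) ^ T) ^ 2 * (1 + 4 * b * p) ^ T) hμ ?_ ?_
  · refine h.trans (le_of_eq ?_)
    field_simp
    ring
  · rw [Finset.sum_congr rfl h_one, Finset.sum_const, hKc, nsmul_eq_mul]
  · have : ∀ i ∈ Kᶜ, ∑ j ∈ Kᶜ, designExp (T := T) p (fun X => ind (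
        outcome X K = outcome X (insert i K) ∧ outcome X K = outcome X (insert j K))) ≤
        (1 - b) ^ T + (n - k : ℕ) * (((1 - b) ^ T) ^ 2 * (1 + 4 * b * p) ^ T) := by
      intro i hi
      rw [← Finset.add_sum_erase _ _ hi]
      refine add_le_add (le_of_eq ?_) ?_
      · simp only [and_self]
        exact h_one i hi
      · refine (Finset.sum_le_sum (g := fun _ => ((1 - b) ^ T) ^ 2 * (1 + 4 * b * p) ^ T)
          fun j hj => ?_).trans ?_
        · rw [Finset.mem_erase] at hj
          have hni : i ∉ K := Finset.mem_compl.1 hi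
          have hnj : j ∉ insert i K := by
            rw [Finset.mem_insert, not_or]
            exact ⟨hj.1, Finset.mem_compl.1 hj.2⟩
          have hsub : K ⊆ insert j (insert i K) :=
            (Finset.subset_insert i K).trans (Finset.subset_insert j _)
          -- If i and j are both hidden, adjoining both still leaves the outcomes of `K` unchanged.
          refine (designExp_mono h0 h1 (G := fun X => ind (outcome X K =
            outcome X (insert j (insert i K)))) fun X => ind_mono fun h => ?_).trans ?_
          · rw [show insert j (insert i K) = insert i K ∪ insert j K by
              ext; simp [Finset.mem_insert],
              outcome_union_eq (h.1.symm.trans h.2)]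
            exact h.2
          · rw [designExp_outcome_eq_subset p hsub, Finset.card_insert_of_notMem hnj,
              Finset.card_insert_of_notMem hni, hK, ← pow_mul, mul_comm T, pow_mul, ← mul_pow]
            have e : 1 - ((1 - p) ^ k - (1 - p) ^ (k + 1 + 1)) = 1 - 2 * b + b * p := by
              rw [← hb]; ring
            rw [e]
            refine pow_le_pow_left₀ (by nlinarith) ?_ T
            -- Hidden items are slightly positively correlated. The factor 4 in 1 + 4bp absorbs the
            -- excess bp because (1 - b)² ≥ 1/4.
            have h4 : (1 : ℝ) ≤ 4 * (1 - b) ^ 2 := by nlinarith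
            have hbp : 0 ≤ b * p := by positivity
            nlinarith [mul_le_mul_of_nonneg_left h4 hbp, sq_nonneg b]
        · rw [Finset.sum_const, nsmul_eq_mul]
          have : ((Kᶜ.erase i).card : ℝ) ≤ (n - k : ℕ) := by
            rw [← hKc]; exact Nat.cast_le.2 (Finset.card_le_card (Finset.erase_subset i _))
          gcongr
    refine (Finset.sum_le_sum this).trans (le_of_eq ?_)
    rw [Finset.sum_const, hKc, nsmul_eq_mul]
    ring

/-- The set with i replaced by j lies between `K.erase i` and `insert j K`, which have equal
outcomes. -/
theorem exists_ambiguous {X : Design n T} {K : Finset (Fin n)} {i j : Fin n} (hi : i ∈ K)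
    (hj : j ∉ K) (hio : outcome X (K.erase i) = outcome X K)
    (hjo : outcome X K = outcome X (insert j K)) :
    ∃ L : Finset (Fin n), L.card = K.card ∧ L ≠ K ∧ outcome X L = outcome X K := by
  have hje : j ∉ K.erase i := fun h => hj (Finset.mem_of_mem_erase h)
  refine ⟨insert j (K.erase i), ?_, ?_, ?_⟩
  · rw [Finset.card_insert_of_notMem hje, Finset.card_erase_add_one hi]
  · intro h
    exact hj (h ▸ Finset.mem_insert_self j _)
  · rw [hjo]
    exact outcome_eq_of_subset (Finset.subset_insert j _)
      (Finset.insert_subset_insert j (Finset.erase_subset i K)) (hio.trans hjo)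

/-- A lower bound for the error of any detector by masked and hidden items. -/
theorem le_errorProb_of_masked (h0 : 0 ≤ p) (h1 : p ≤ 1) {k : ℕ} (hk : 2 ≤ k) (hkn : k < n)
    (D : Detector n T) {a b : ℝ} (ha : (1 - p) ^ (k - 1) - (1 - p) ^ k = a) (ha2 : a < 1 / 2)
    (hb : p * (1 - p) ^ k = b) (hb2 : b ≤ 1 / 2) :
    (1 - 1 / (k * (1 - a) ^ T) -
      (1 / ((n - k : ℕ) * (1 - b) ^ T) + ((1 + 4 * b * p) ^ T - 1))) / 2 ≤ errorProb p k D := by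
  refine half_le_errorProb h0 h1 hkn.le D fun K hK => ?_
  have hm := designExp_no_masked_le (T := T) h0 h1 hK hk ha ha2
  have hh := designExp_no_hidden_le (T := T) h0 h1 hK hkn hb hb2
  have hall : (1 : ℝ) ≤ designExp (T := T) p (fun X => (ind (∃ L : Finset (Fin n), L.card = k ∧
      L ≠ K ∧ outcome X L = outcome X K) +
      ind (¬ ∃ i ∈ K, outcome X (K.erase i) = outcome X K)) +
      ind (¬ ∃ j ∈ Kᶜ, outcome X K = outcome X (insert j K))) := by
    rw [← designExp_one (n := n) (T := T) p]
    refine designExp_mono h0 h1 fun X => ?_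
    by_cases hA : ∃ i ∈ K, outcome X (K.erase i) = outcome X K
    · by_cases hB : ∃ j ∈ Kᶜ, outcome X K = outcome X (insert j K)
      · obtain ⟨i, hi, hio⟩ := hA
        obtain ⟨j, hj, hjo⟩ := hB
        have := exists_ambiguous hi (Finset.mem_compl.1 hj) hio hjo
        rw [hK] at this
        rw [ind_of_true this]
        linarith [ind_nonneg (¬ ∃ i ∈ K, outcome X (K.erase i) = outcome X K),
          ind_nonneg (¬ ∃ j ∈ Kᶜ, outcome X K = outcome X (insert j K))]
      · rw [ind_of_true hB]
        exact le_add_of_nonneg_left (add_nonneg (ind_nonneg _) (ind_nonneg _))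
    · rw [ind_of_true hA]
      linarith [ind_nonneg (∃ L : Finset (Fin n), L.card = k ∧ L ≠ K ∧ outcome X L = outcome X K),
          ind_nonneg (¬ ∃ j ∈ Kᶜ, outcome X K = outcome X (insert j K))]
  rw [designExp_add, designExp_add] at hall
  linarith

end converse

/-! ### Entropy expansions, the concavity inequality and binomial estimates. -/

section analysis

theorem exp_neg_le_quadratic {x : ℝ} (hx : 0 ≤ x) : Real.exp (-x) ≤ 1 - x + x ^ 2 / 2 := by
  have h := Real.quadratic_le_exp_of_nonneg hx
  rw [Real.exp_neg, inv_le_iff_one_le_mul₀ (Real.exp_pos x)]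
  have h2 : 0 < 1 - x + x ^ 2 / 2 := by nlinarith [sq_nonneg (x - 1)]
  -- (1 + x + x²/2)(1 - x + x²/2) = 1 + x⁴/4.
  nlinarith [mul_le_mul_of_nonneg_left h h2.le, sq_nonneg (x ^ 2)]

theorem exp_le_add_sq_mul_exp {x : ℝ} (hx : 0 ≤ x) :
    Real.exp x ≤ 1 + x + x ^ 2 * Real.exp x := by
  have h := Real.add_one_le_exp (-x)
  have h1 : Real.exp (-x) * Real.exp x = 1 := by rw [← Real.exp_add]; simp
  have h2 : Real.exp x - 1 ≤ x * Real.exp x := by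
    nlinarith [mul_le_mul_of_nonneg_right h (Real.exp_pos x).le]
  nlinarith [mul_le_mul_of_nonneg_left h2 hx]

theorem sq_mul_exp_neg_le_one {x : ℝ} (hx : 0 ≤ x) : x ^ 2 * Real.exp (-x) ≤ 1 := by
  have h := Real.quadratic_le_exp_of_nonneg (show 0 ≤ x / 2 by linarith)
  have h1 : x ≤ Real.exp (x / 2) := by nlinarith [sq_nonneg (x / 2 - 1)]
  have h2 : x ^ 2 ≤ Real.exp x := by
    calc x ^ 2 ≤ Real.exp (x / 2) ^ 2 := pow_le_pow_left₀ hx h1 2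
      _ = Real.exp x := by rw [← Real.exp_nat_mul]; congr 1; push_cast; ring
  rw [Real.exp_neg, ← div_eq_mul_inv, div_le_one (Real.exp_pos x)]
  exact h2

/-- First-order expansion of u^{1+s} at s = 0. The error is uniform in u because u log² u ≤ 1. -/
theorem mul_neg_log_sub_le {u s : ℝ} (h0 : 0 ≤ u) (h1 : u ≤ 1) (hs : 0 ≤ s) :
    s * (u * Real.log u⁻¹) - s ^ 2 / 2 ≤ u - u ^ (1 + s) := by
  rcases h0.eq_or_lt with h | h
  · rw [← h, Real.zero_rpow (by linarith)]
    simp; positivity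
  · have hl : 0 ≤ -Real.log u := by linarith [Real.log_nonpos h0 h1]
    have hu : Real.exp (-(-Real.log u)) = u := by rw [neg_neg, Real.exp_log h]
    have e1 := exp_neg_le_quadratic (mul_nonneg hs hl)
    have e2 := sq_mul_exp_neg_le_one hl
    rw [hu] at e2
    have e3 : u ^ (1 + s) = u * Real.exp (-(s * -Real.log u)) := by
      rw [Real.rpow_add h, Real.rpow_one, Real.rpow_def_of_pos h]; congr 2; ring
    rw [e3, Real.log_inv]
    nlinarith [mul_le_mul_of_nonneg_left e1 h0, mul_le_mul_of_nonneg_left e2 (sq_nonneg s)]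

theorem mul_binEntropy_sub_le {u s : ℝ} (h0 : 0 ≤ u) (h1 : u ≤ 1) (hs : 0 ≤ s) :
    s * Real.binEntropy u - s ^ 2 ≤ 1 - u ^ (1 + s) - (1 - u) ^ (1 + s) := by
  have e1 := mul_neg_log_sub_le h0 h1 hs
  have e2 := mul_neg_log_sub_le (u := 1 - u) (by linarith) (by linarith) hs
  rw [Real.binEntropy]
  linarith

/-- The expansion in the other direction. As s ≤ 1/2, u^{1-s} ≤ u^{1/2}, and u^{1/2} log² u ≤ 4
gives the constant. -/
theorem rpow_one_sub_le {u s : ℝ} (h0 : 0 ≤ u) (h1 : u ≤ 1) (hs : 0 ≤ s) (hs2 : s ≤ 1 / 2) :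
    u ^ (1 - s) ≤ u + s * (u * Real.log u⁻¹) + 4 * s ^ 2 := by
  rcases h0.eq_or_lt with h | h
  · rw [← h, Real.zero_rpow (by linarith)]
    simp; positivity
  · have hl : 0 ≤ -Real.log u := by linarith [Real.log_nonpos h0 h1]
    have e1 := exp_le_add_sq_mul_exp (mul_nonneg hs hl)
    have e2 := sq_mul_exp_neg_le_one (show 0 ≤ -Real.log u / 2 by linarith)
    have e3 : u ^ (1 - s) = u * Real.exp (s * -Real.log u) := by
      rw [sub_eq_add_neg, Real.rpow_add h, Real.rpow_one, Real.rpow_def_of_pos h]; congr 2; ring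
    have e4 : u * Real.exp (s * -Real.log u) ≤ Real.exp (-(-Real.log u / 2)) := by
      conv_lhs => rw [← Real.exp_log h, ← Real.exp_add]
      rw [Real.exp_le_exp, Real.log_exp]
      nlinarith
    have e5 : u * ((s * -Real.log u) ^ 2 * Real.exp (s * -Real.log u)) ≤ 4 * s ^ 2 := by
      calc u * ((s * -Real.log u) ^ 2 * Real.exp (s * -Real.log u))
          = (s * -Real.log u) ^ 2 * (u * Real.exp (s * -Real.log u)) := by ring
        _ ≤ (s * -Real.log u) ^ 2 * Real.exp (-(-Real.log u / 2)) := by gcongr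
        _ = 4 * s ^ 2 * ((-Real.log u / 2) ^ 2 * Real.exp (-(-Real.log u / 2))) := by ring
        _ ≤ 4 * s ^ 2 * 1 := by gcongr
        _ = 4 * s ^ 2 := mul_one _
    rw [e3, Real.log_inv]
    nlinarith [mul_le_mul_of_nonneg_left e1 h0]

theorem rpow_one_sub_add_le {q s : ℝ} (h0 : 0 ≤ q) (h1 : q ≤ 1) (hs : 0 ≤ s) (hs2 : s ≤ 1 / 2) :
    q ^ (1 - s) + (1 - q) ^ (1 - s) ≤ Real.exp (s * Real.binEntropy q + 8 * s ^ 2) := by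
  have e1 := rpow_one_sub_le h0 h1 hs hs2
  have e2 := rpow_one_sub_le (u := 1 - q) (by linarith) (by linarith) hs hs2
  have e3 := Real.add_one_le_exp (s * Real.binEntropy q + 8 * s ^ 2)
  rw [Real.binEntropy] at e3 ⊢
  linarith

/-- With a = e^{-x} this is -log(1 - a)/a, the slope of a chord from the origin of a convex
function, hence increasing in a. It is the derivative of e^x H(e^{-x}). -/
theorem neg_exp_mul_log_antitoneOn :
    AntitoneOn (fun x : ℝ => -(Real.exp x * Real.log (1 - Real.exp (-x)))) (Set.Ioi 0) := by
  intro x hx y hy hxy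
  have hx' : Real.exp (-x) < 1 := by simpa using hx
  have hle : Real.exp (-y) ≤ Real.exp (-x) := Real.exp_le_exp.2 (by linarith)
  have hxp := Real.exp_pos (-x)
  have hyp := Real.exp_pos (-y)
  set a := Real.exp (-x) with ha
  set b := Real.exp (-y) with hb
  have h := strictConcaveOn_log_Ioi.concaveOn.2
    (show (1 - a) ∈ Set.Ioi (0 : ℝ) from Set.mem_Ioi.2 (sub_pos.2 hx')) (show (1 : ℝ) ∈ Set.Ioi 0 from Set.mem_Ioi.2 one_pos)
    (show 0 ≤ b / a by positivity) (show 0 ≤ 1 - b / a by rw [sub_nonneg, div_le_one hxp]; exact hle)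
    (by ring)
  simp only [smul_eq_mul, Real.log_one, mul_zero, add_zero] at h
  have e : b / a * (1 - a) + (1 - b / a) * 1 = 1 - b := by field_simp; ring
  rw [e] at h
  have ex : Real.exp x = a⁻¹ := by rw [ha, Real.exp_neg, inv_inv]
  have ey : Real.exp y = b⁻¹ := by rw [hb, Real.exp_neg, inv_inv]
  simp only [ex, ey]
  rw [neg_le_neg_iff]
  calc a⁻¹ * Real.log (1 - a) = b⁻¹ * (b / a * Real.log (1 - a)) := by field_simp
    _ ≤ b⁻¹ * Real.log (1 - b) := by gcongr

theorem hasDerivAt_exp_mul_binEntropy {x : ℝ} (hx : 0 < x) :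
    HasDerivAt (fun x : ℝ => Real.exp x * Real.binEntropy (Real.exp (-x)))
      (-(Real.exp x * Real.log (1 - Real.exp (-x)))) x := by
  have hx1 : Real.exp (-x) ≠ 1 := by
    rw [Ne, Real.exp_eq_one_iff]; linarith
  have h1 : HasDerivAt (fun x : ℝ => Real.exp (-x)) (Real.exp (-x) * -1) x :=
    (hasDerivAt_neg x).exp
  have h2 := (Real.hasDerivAt_exp x).mul
    ((Real.hasDerivAt_binEntropy (Real.exp_ne_zero (-x)) hx1).comp x h1)
  refine h2.congr_deriv ?_
  have he : Real.exp x * Real.exp (-x) = 1 := by rw [← Real.exp_add]; simp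
  simp only [Function.comp, Real.binEntropy, Real.log_inv, Real.log_exp]
  ring

theorem concaveOn_exp_mul_binEntropy :
    ConcaveOn ℝ (Set.Ici 0) fun x : ℝ => Real.exp x * Real.binEntropy (Real.exp (-x)) := by
  refine AntitoneOn.concaveOn_of_deriv (convex_Ici 0) ?_ ?_ ?_
  · exact (Real.continuous_exp.mul (Real.binEntropy_continuous.comp (by fun_prop))).continuousOn
  · rw [interior_Ici]
    exact fun x hx => (hasDerivAt_exp_mul_binEntropy hx).differentiableAt.differentiableWithinAt
  · rw [interior_Ici]
    exact neg_exp_mul_log_antitoneOn.congr fun x hx => (hasDerivAt_exp_mul_binEntropy hx).deriv.symm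

/-- The information about a proportion `α` of the defectives is at least the proportion `α` of
the total information. -/
theorem mul_binEntropy_le {ν α : ℝ} (hν : 0 ≤ ν) (h0 : 0 ≤ α) (h1 : α ≤ 1) :
    α * Real.binEntropy (Real.exp (-ν)) ≤
      Real.exp (-(ν * (1 - α))) * Real.binEntropy (Real.exp (-(ν * α))) := by
  -- Concavity between 0 and ν; the function vanishes at 0 since H(1) = 0.
  have h := concaveOn_exp_mul_binEntropy.2 (Set.mem_Ici.2 hν) (Set.mem_Ici.2 le_rfl) h0
    (sub_nonneg.2 h1) (by ring)
  simp only [smul_eq_mul, mul_zero, add_zero, neg_zero, Real.exp_zero, Real.binEntropy_one] at h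
  have h2 := mul_le_mul_of_nonneg_left h (Real.exp_pos (-ν)).le
  calc α * Real.binEntropy (Real.exp (-ν))
      = Real.exp (-ν) * (α * (Real.exp ν * Real.binEntropy (Real.exp (-ν)))) := by
        have : Real.exp (-ν) * Real.exp ν = 1 := by rw [← Real.exp_add]; simp
        linear_combination (-α * Real.binEntropy (Real.exp (-ν))) * this
    _ ≤ _ := h2
    _ = Real.exp (-(ν * (1 - α))) * Real.binEntropy (Real.exp (-(ν * α))) := by
        rw [← mul_assoc, ← Real.exp_add, mul_comm α ν]
        congr 2
        ring

/-- For few exchanges, x = νl/k is near 0 and the additive error s² of `mul_binEntropy_sub_le` would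
swamp the main term. Here the error is relative to x. -/
theorem mul_sub_le_one_sub_rpow {x s : ℝ} (hx : 0 < x) (hs0 : 0 ≤ s) (hs1 : s ≤ 1) :
    x * (1 + s - (2 * x + x ^ s)) ≤
      1 - Real.exp (-x) ^ (1 + s) - (1 - Real.exp (-x)) ^ (1 + s) := by
  have e1 : Real.exp (-x) ^ (1 + s) ≤ 1 - (1 + s) * x + 2 * x ^ 2 := by
    rw [← Real.exp_mul]
    have := exp_neg_le_quadratic (show 0 ≤ x * (1 + s) by positivity)
    rw [show -x * (1 + s) = -(x * (1 + s)) by ring]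
    have h4 : (1 + s) ^ 2 ≤ 4 := by nlinarith
    nlinarith [mul_le_mul_of_nonneg_left h4 (sq_nonneg x)]
  have e2 : (1 - Real.exp (-x)) ^ (1 + s) ≤ x * x ^ s := by
    have h : x ^ (1 + s) = x * x ^ s := by rw [Real.rpow_add hx, Real.rpow_one]
    rw [← h]
    refine Real.rpow_le_rpow ?_ ?_ (by linarith)
    · have : Real.exp (-x) ≤ 1 := Real.exp_le_one_iff.2 (by linarith)
      linarith
    · linarith [Real.add_one_le_exp (-x)]
  nlinarith

theorem choose_le_exp_mul_div_pow {n l : ℕ} (hl : 1 ≤ l) :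
    (n.choose l : ℝ) ≤ (Real.exp 1 * n / l) ^ l := by
  have hl0 : (0 : ℝ) < l := by positivity
  have h1 := Nat.choose_le_pow_div (α := ℝ) l n
  have h2 := Real.pow_div_factorial_le_exp (l : ℝ) hl0.le l
  have hf : (0 : ℝ) < l.factorial := by positivity
  refine h1.trans ?_
  rw [div_pow, mul_pow, ← Real.exp_nat_mul, mul_one, div_le_div_iff₀ hf (by positivity)]
  rw [div_le_iff₀ hf] at h2
  calc (n : ℝ) ^ l * (l : ℝ) ^ l ≤ (n : ℝ) ^ l * (Real.exp l * l.factorial) := by gcongr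
    _ = _ := by ring

theorem log_choose_le {n k : ℕ} (hk : 1 ≤ k) (hkn : k ≤ n) :
    Real.log (n.choose k) ≤ k * (Real.log (n / k) + 1) := by
  have hk0 : (0 : ℝ) < k := by positivity
  have hn0 : (0 : ℝ) < n := by exact_mod_cast (by omega : 0 < n)
  have hN : (0 : ℝ) < n.choose k := Nat.cast_pos.2 (Nat.choose_pos hkn)
  calc Real.log (n.choose k) ≤ Real.log ((Real.exp 1 * n / k) ^ k) :=
        Real.log_le_log hN (choose_le_exp_mul_div_pow hk)
    _ = k * (Real.log (n / k) + 1) := by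
        rw [Real.log_pow, mul_div_assoc, Real.log_mul (by positivity) (by positivity), Real.log_exp]
        ring

theorem le_log_choose {n k : ℕ} (hk : 1 ≤ k) (hkn : 2 * k ≤ n) :
    k * (Real.log (n / k) - Real.log 2) ≤ Real.log (n.choose k) := by
  have hk0 : (0 : ℝ) < k := by positivity
  have hn0 : (0 : ℝ) < n := by exact_mod_cast (by omega : 0 < n)
  have h1 := Nat.pow_le_choose (α := ℝ) k n
  have hf : (k.factorial : ℝ) ≤ (k : ℝ) ^ k := by exact_mod_cast Nat.factorial_le_pow k
  have h2 : ((n : ℝ) / 2 / k) ^ k ≤ n.choose k := by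
    refine le_trans ?_ h1
    rw [div_pow]
    have : (n : ℝ) / 2 ≤ ((n + 1 - k : ℕ) : ℝ) := by
      rw [Nat.cast_sub (by omega)]
      push_cast
      have : (2 : ℝ) * k ≤ n := by exact_mod_cast hkn
      linarith
    gcongr
  calc k * (Real.log (n / k) - Real.log 2) = Real.log (((n : ℝ) / 2 / k) ^ k) := by
        rw [Real.log_pow, ← Real.log_div (by positivity) (by positivity)]
        congr 2
        field_simp
    _ ≤ _ := Real.log_le_log (by positivity) h2

end analysis

/-! ### Logarithmic sizes of k, of the binomial coefficient and of the test count. -/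

section asymptotics

/-- The size conditions on the number of defectives used in the asymptotic estimates. -/
structure SparseBounds (θ : ℝ) (k : ℕ → ℕ) (c : ℝ) : Prop where
  one_le : ∀ᶠ n : ℕ in atTop, 1 ≤ k n
  two_mul_le : ∀ᶠ n : ℕ in atTop, 2 * k n ≤ n
  log_le : ∀ᶠ n : ℕ in atTop, Real.log (k n) ≤ θ * Real.log n + c
  le_log : ∀ᶠ n : ℕ in atTop, θ * Real.log n - c ≤ Real.log (k n)

theorem tendsto_log_natCast : Tendsto (fun n : ℕ => Real.log n) atTop atTop :=
  Real.tendsto_log_atTop.comp tendsto_natCast_atTop_atTop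

theorem exists_sparseBounds {θ : ℝ} (h1 : θ < 1) {k : ℕ → ℕ}
    (hk : (fun n : ℕ => (k n : ℝ)) =Θ[atTop] fun n : ℕ => (n : ℝ) ^ θ) :
    ∃ c, SparseBounds θ k c := by
  obtain ⟨c₁, hc₁, hu⟩ := hk.1.exists_pos
  obtain ⟨c₂, hc₂, hl⟩ := hk.2.exists_pos
  have hpos : ∀ᶠ n : ℕ in atTop, (k n : ℝ) ≤ c₁ * (n : ℝ) ^ θ ∧ (n : ℝ) ^ θ ≤ c₂ * k n ∧
      1 ≤ k n ∧ 1 ≤ n := by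
    filter_upwards [hu.bound, hl.bound, eventually_ge_atTop 1] with n h1 h2 hn
    have hn0 : (0 : ℝ) < n := by exact_mod_cast hn
    have hp := Real.rpow_pos_of_pos hn0 θ
    rw [Real.norm_of_nonneg hp.le, Real.norm_of_nonneg (Nat.cast_nonneg _)] at h1 h2
    refine ⟨h1, h2, ?_, hn⟩
    rw [Nat.one_le_iff_ne_zero]
    intro h
    rw [h, Nat.cast_zero, mul_zero] at h2
    linarith
  have hlogs : ∀ᶠ n : ℕ in atTop, Real.log (k n) ≤ θ * Real.log n + (|Real.log c₁| + |Real.log c₂|) ∧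
      θ * Real.log n - (|Real.log c₁| + |Real.log c₂|) ≤ Real.log (k n) := by
    filter_upwards [hpos] with n ⟨h1, h2, h3, h4⟩
    have hn0 : (0 : ℝ) < n := by exact_mod_cast h4
    have hk0 : (0 : ℝ) < k n := by exact_mod_cast h3
    have hp := Real.rpow_pos_of_pos hn0 θ
    have e1 := Real.log_le_log hk0 h1
    have e2 := Real.log_le_log hp h2
    rw [Real.log_mul hc₁.ne' hp.ne', Real.log_rpow hn0] at e1
    rw [Real.log_mul hc₂.ne' hk0.ne', Real.log_rpow hn0] at e2
    constructor
    · linarith [le_abs_self (Real.log c₁), abs_nonneg (Real.log c₂)]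
    · linarith [le_abs_self (Real.log c₂), abs_nonneg (Real.log c₁)]
  refine ⟨|Real.log c₁| + |Real.log c₂|, hpos.mono fun n h => h.2.2.1, ?_,
    hlogs.mono fun n h => h.1, hlogs.mono fun n h => h.2⟩
  have hlim : ∀ᶠ n : ℕ in atTop,
      (|Real.log c₁| + |Real.log c₂| + Real.log 2) / (1 - θ) ≤ Real.log n :=
    tendsto_log_natCast.eventually_ge_atTop _
  filter_upwards [hlogs, hlim, hpos] with n h2 h3 h4
  have hn0 : (0 : ℝ) < n := by exact_mod_cast h4.2.2.2
  have hk0 : (0 : ℝ) < k n := by exact_mod_cast h4.2.2.1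
  rw [div_le_iff₀ (by linarith)] at h3
  have : Real.log (2 * k n) ≤ Real.log n := by
    rw [Real.log_mul two_ne_zero hk0.ne']
    linarith [h2.1]
  have := (Real.log_le_log_iff (by positivity) hn0).1 this
  exact_mod_cast this

namespace SparseBounds

variable {θ c : ℝ} {k : ℕ → ℕ}

theorem log_div_ge (h : SparseBounds θ k c) :
    ∀ᶠ n : ℕ in atTop, (1 - θ) * Real.log n - c ≤ Real.log (n / k n) := by
  filter_upwards [h.one_le, h.log_le, eventually_ge_atTop 1] with n h1 h2 hn
  rw [Real.log_div (by exact_mod_cast (by omega : n ≠ 0)) (by exact_mod_cast (by omega : k n ≠ 0))]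
  linarith

theorem log_div_le (h : SparseBounds θ k c) :
    ∀ᶠ n : ℕ in atTop, Real.log (n / k n) ≤ (1 - θ) * Real.log n + c := by
  filter_upwards [h.one_le, h.le_log, eventually_ge_atTop 1] with n h1 h2 hn
  rw [Real.log_div (by exact_mod_cast (by omega : n ≠ 0)) (by exact_mod_cast (by omega : k n ≠ 0))]
  linarith

theorem tendsto_log_div (h : SparseBounds θ k c) (hθ : θ < 1) :
    Tendsto (fun n : ℕ => Real.log (n / k n)) atTop atTop := by
  refine tendsto_atTop_mono' _ h.log_div_ge ?_
  exact tendsto_atTop_add_const_right _ (-c)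
    (tendsto_log_natCast.const_mul_atTop (by linarith : (0 : ℝ) < 1 - θ))

theorem tendsto_log_choose (h : SparseBounds θ k c) (hθ : θ < 1) :
    Tendsto (fun n : ℕ => Real.log (n.choose (k n))) atTop atTop := by
  refine tendsto_atTop_mono' _ ?_
    (tendsto_atTop_add_const_right _ (-Real.log 2) (h.tendsto_log_div hθ))
  filter_upwards [h.one_le, h.two_mul_le, (h.tendsto_log_div hθ).eventually_ge_atTop (Real.log 2)]
    with n h1 h2 h3
  refine le_trans ?_ (le_log_choose h1 h2)
  have : (1 : ℝ) ≤ k n := by exact_mod_cast h1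
  nlinarith

end SparseBounds

/-- The largest number of tests that keeps the rate at least `R`. -/
noncomputable def testCount (k : ℕ → ℕ) (R : ℝ) (n : ℕ) : ℕ :=
  ⌊Real.logb 2 (n.choose (k n)) / R⌋₊

theorem testCount_le {k : ℕ → ℕ} {R : ℝ} (hR : 0 < R) (n : ℕ) :
    (testCount k R n : ℝ) ≤ Real.logb 2 (n.choose (k n)) / R := by
  refine Nat.floor_le (div_nonneg ?_ hR.le)
  unfold Real.logb
  exact div_nonneg (Real.log_natCast_nonneg _) (Real.log_nonneg one_le_two)

theorem le_testCount {θ c : ℝ} {k : ℕ → ℕ} (h : SparseBounds θ k c) {R : ℝ} (hR : 0 < R) :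
    ∀ᶠ n : ℕ in atTop, (k n : ℝ) * ((Real.log (n / k n) - Real.log 2) / (R * Real.log 2)) - 1 ≤
      testCount k R n := by
  have hl2 : 0 < Real.log 2 := Real.log_pos one_lt_two
  filter_upwards [h.one_le, h.two_mul_le] with n h1 h2
  have h3 := le_log_choose h1 h2
  have h4 := (Nat.lt_floor_add_one (Real.logb 2 (n.choose (k n)) / R)).le
  rw [sub_le_iff_le_add]
  refine le_trans ?_ h4
  rw [Real.logb, div_div, ← mul_div_assoc, mul_comm R]
  gcongr

/-- T/k grows like (1 - θ) log n / (R log 2). The extra 1 covers the rounding of T, as k ≥ 1. -/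
theorem mul_log_sub_le_testCount {θ c : ℝ} {k : ℕ → ℕ} (h : SparseBounds θ k c) {R : ℝ}
    (hR : 0 < R) : ∀ᶠ n : ℕ in atTop, (1 - θ) / (R * Real.log 2) * Real.log n -
      ((c + Real.log 2) / (R * Real.log 2) + 1) ≤ testCount k R n / k n := by
  have hl2 : 0 < Real.log 2 := Real.log_pos one_lt_two
  filter_upwards [le_testCount h hR, h.log_div_ge, h.one_le] with n h1 h2 h3
  have hk : (1 : ℝ) ≤ k n := by exact_mod_cast h3
  rw [le_div_iff₀ (by linarith)]
  refine le_trans ?_ h1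
  have h4 : ((1 - θ) * Real.log n - c - Real.log 2) / (R * Real.log 2) ≤
      (Real.log (n / k n) - Real.log 2) / (R * Real.log 2) := by gcongr
  have h5 : (1 - θ) / (R * Real.log 2) * Real.log n - ((c + Real.log 2) / (R * Real.log 2) + 1) =
      ((1 - θ) * Real.log n - c - Real.log 2) / (R * Real.log 2) - 1 := by
    field_simp; ring
  rw [h5]
  nlinarith

end asymptotics

/-! ### The swap bound at p = 1 - e^{-ν/k}, and exchanges of few defectives. -/

section achievability

variable {n k l T : ℕ} {ν s : ℝ}

theorem one_sub_pow_eq_exp (k m : ℕ) (ν : ℝ) :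
    (1 - (1 - Real.exp (-(ν / k)))) ^ m = Real.exp (-(ν * (m / k))) := by
  rw [sub_sub_cancel, ← Real.exp_nat_mul]
  congr 1
  ring

/-- Let u and w be the probabilities that a test misses l given items and the k - l retained
defectives. The base of the T-th power is then at most 1 - w(1 - u^{1+s} - (1-u)^{1+s}), and 1 - y ≤
e^{-y}. -/
theorem swapBound_le (hk : 1 ≤ k) (hlk : l ≤ k) (hν : 0 < ν) :
    swapBound n T k (1 - Real.exp (-(ν / k))) l s ≤
      (k.choose l : ℝ) * (((n - k).choose l : ℝ) ^ s * Real.exp (-(T *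
        (Real.exp (-(ν * (1 - l / k))) * (1 - Real.exp (-(ν * (l / k))) ^ (1 + s) -
          (1 - Real.exp (-(ν * (l / k)))) ^ (1 + s)))))) := by
  have hk0 : (0 : ℝ) < k := by positivity
  have hw : ((k - l : ℕ) : ℝ) / k = 1 - l / k := by
    rw [Nat.cast_sub hlk]; field_simp
  unfold swapBound
  rw [one_sub_pow_eq_exp, one_sub_pow_eq_exp, one_sub_pow_eq_exp, hw, div_self hk0.ne', mul_one]
  set u := Real.exp (-(ν * (l / k))) with hu
  set w := Real.exp (-(ν * (1 - l / k))) with hw'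
  have hq : Real.exp (-ν) = w * u := by rw [hu, hw', ← Real.exp_add]; congr 1; ring
  have hu0 : 0 < u := Real.exp_pos _
  have hw0 : 0 < w := Real.exp_pos _
  have hl1 : (l : ℝ) / k ≤ 1 := by rw [div_le_one hk0]; exact_mod_cast hlk
  have hu1 : u ≤ 1 := by rw [hu, Real.exp_le_one_iff]; have : 0 ≤ ν * (l / k) := by positivity
                         linarith
  have hw1 : w ≤ 1 := by
    rw [hw', Real.exp_le_one_iff]
    have : 0 ≤ ν * (1 - l / k) := mul_nonneg hν.le (by linarith)
    linarith
  have hu2 : 0 ≤ 1 - u := by linarith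
  have e1 : u * u ^ s = u ^ (1 + s) := by rw [Real.rpow_add hu0, Real.rpow_one]
  rw [hq]
  have e2 : (1 - u) * (1 - u) ^ s ≤ (1 - u) ^ (1 + s) := by
    rcases hu2.eq_or_lt with h | h
    · rw [← h, zero_mul]; positivity
    · rw [Real.rpow_add h, Real.rpow_one]
  have hbase : 1 - w + w * u * u ^ s + (w - w * u) * (1 - u) ^ s ≤
      Real.exp (-(w * (1 - u ^ (1 + s) - (1 - u) ^ (1 + s)))) := by
    refine le_trans ?_ (Real.add_one_le_exp _)
    nlinarith
  have hbase0 : 0 ≤ 1 - w + w * u * u ^ s + (w - w * u) * (1 - u) ^ s := by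
    have : 0 ≤ (w - w * u) * (1 - u) ^ s := mul_nonneg (by nlinarith) (by positivity)
    have : 0 ≤ w * u * u ^ s := by positivity
    linarith
  have h3 := pow_le_pow_left₀ hbase0 hbase T
  rw [← Real.exp_nat_mul, mul_neg] at h3
  gcongr

/-- The crude bounds k^l and n^l on the binomials suffice here: every exponent is linear in l, which
prepares a geometric series. -/
theorem swapBound_le_pow (hk : 1 ≤ k) (hkn : k ≤ n) (hl : 1 ≤ l) (hlk : l ≤ k) (hν : 0 < ν) (hs0 : 0 ≤ s)
    (hs1 : s ≤ 1) {κ : ℝ} (hκ : 2 * (ν * (l / k)) + (ν * (l / k)) ^ s ≤ κ) (hκ1 : κ ≤ 1) :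
    swapBound n T k (1 - Real.exp (-(ν / k))) l s ≤
      Real.exp (Real.log k + s * Real.log n -
        T / k * (ν * Real.exp (-ν)) * ((1 + s) * (1 - κ))) ^ l := by
  have hk0 : (0 : ℝ) < k := by positivity
  have hn0 : (0 : ℝ) < n := by exact_mod_cast (by omega : 0 < n)
  have hl0 : (0 : ℝ) < l := by positivity
  have hx : 0 < ν * (l / k) := by positivity
  refine (swapBound_le hk hlk hν).trans ?_
  have h1 : (k.choose l : ℝ) ≤ (k : ℝ) ^ l := by exact_mod_cast Nat.choose_le_pow k l
  have h2 : ((n - k).choose l : ℝ) ^ s ≤ ((n : ℝ) ^ l) ^ s := by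
    refine Real.rpow_le_rpow (Nat.cast_nonneg _) ?_ hs0
    calc ((n - k).choose l : ℝ) ≤ ((n - k : ℕ) : ℝ) ^ l := by exact_mod_cast Nat.choose_le_pow _ l
      _ ≤ (n : ℝ) ^ l := by gcongr; omega
  have h3 := mul_sub_le_one_sub_rpow hx hs0 hs1
  have hG : ν * (l / k) * ((1 + s) * (1 - κ)) ≤ 1 - Real.exp (-(ν * (l / k))) ^ (1 + s) -
      (1 - Real.exp (-(ν * (l / k)))) ^ (1 + s) := by
    refine le_trans ?_ h3
    have hκ0 : 0 ≤ κ := le_trans (by positivity) hκ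
    refine mul_le_mul_of_nonneg_left ?_ hx.le
    nlinarith
  have hw : Real.exp (-ν) ≤ Real.exp (-(ν * (1 - l / k))) := by
    rw [Real.exp_le_exp, neg_le_neg_iff]
    have : 0 ≤ (l : ℝ) / k := by positivity
    nlinarith
  have h4 : Real.exp (-ν) * (ν * (l / k) * ((1 + s) * (1 - κ))) ≤
      Real.exp (-(ν * (1 - l / k))) * (1 - Real.exp (-(ν * (l / k))) ^ (1 + s) -
      (1 - Real.exp (-(ν * (l / k)))) ^ (1 + s)) := by
    have : 0 ≤ ν * (l / k) * ((1 + s) * (1 - κ)) :=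
      mul_nonneg hx.le (mul_nonneg (by linarith) (by linarith))
    gcongr
  calc _ ≤ (k : ℝ) ^ l * (((n : ℝ) ^ l) ^ s *
        Real.exp (-(T * (Real.exp (-ν) * (ν * (l / k) * ((1 + s) * (1 - κ))))))) := by
        gcongr
    _ = _ := by
        rw [← Real.exp_log (pow_pos hk0 l), Real.rpow_def_of_pos (pow_pos hn0 l), ← Real.exp_add,
          ← Real.exp_add, ← Real.exp_nat_mul, Real.log_pow, Real.log_pow]
        congr 1
        field_simp
        ring

/-- Exchanges of few defectives. -/
theorem exists_small_swap {θ c : ℝ} {k : ℕ → ℕ} (h : SparseBounds θ k c) {R ν : ℝ} (hR : 0 < R) (hν : 0 < ν)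
    (hA : θ < ν * Real.exp (-ν) * (1 - θ) / (R * Real.log 2)) (h0 : 0 ≤ θ) :
    ∃ δ > 0, ∃ s : ℝ, 0 ≤ s ∧ s ≤ 1 ∧ ∃ r : ℕ → ℝ, Tendsto r atTop (𝓝 0) ∧ (∀ n, 0 ≤ r n) ∧
      ∀ᶠ n : ℕ in atTop, ∀ l, 1 ≤ l → l ≤ k n → ν * (l / k n) ≤ δ →
        swapBound n (testCount k R n) (k n) (1 - Real.exp (-(ν / k n))) l s ≤ r n ^ l := by
  set A := ν * Real.exp (-ν) * (1 - θ) / (R * Real.log 2) with hAdef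
  have hA0 : 0 < A := by linarith
  -- A' lies midway between θ and A, and κ is the relative loss with A(1 - κ) = A'. Then s is small
  -- enough that θ + s - A'(1 + s) ≤ -(A' - θ)/2, the coefficient of log n below.
  set A' := (A + θ) / 2 with hA'
  set κ := 1 - A' / A with hκ
  have hκ0 : 0 < κ := by
    rw [hκ, sub_pos, div_lt_one hA0]; linarith
  have hκ1 : κ ≤ 1 := by
    rw [hκ]
    have : 0 ≤ A' / A := div_nonneg (by linarith) hA0.le
    linarith
  set s := min 1 ((A' - θ) / 2) with hs
  have hs0 : 0 < s := lt_min one_pos (by linarith)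
  have hs1 : s ≤ 1 := min_le_left _ _
  have hs2 : s ≤ (A' - θ) / 2 := min_le_right _ _
  obtain ⟨δ, hδ, hδκ⟩ : ∃ δ > 0, ∀ x, 0 < x → x ≤ δ → 2 * x + x ^ s ≤ κ := by
    have hc : ContinuousAt (fun x : ℝ => 2 * x + x ^ s) 0 :=
      (continuousAt_const.mul continuousAt_id).add (Real.continuousAt_rpow_const 0 s (Or.inr hs0.le))
    have ht : ∀ᶠ x in 𝓝 (0 : ℝ), 2 * x + x ^ s < κ := by
      refine hc.eventually (gt_mem_nhds ?_)
      simpa [Real.zero_rpow hs0.ne'] using hκ0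
    obtain ⟨ε, hε, hb⟩ := Metric.eventually_nhds_iff.1 ht
    refine ⟨ε / 2, by positivity, fun x hx hxe => (hb ?_).le⟩
    rw [Real.dist_eq, sub_zero, abs_of_pos hx]
    linarith
  refine ⟨δ, hδ, s, hs0.le, hs1, fun n => Real.exp (Real.log (k n) + s * Real.log n -
        testCount k R n / k n * (ν * Real.exp (-ν)) * ((1 + s) * (1 - κ))), ?_,
        fun n => (Real.exp_pos _).le, ?_⟩
  · refine Real.tendsto_exp_atBot.comp ?_
    set c' := c + ((c + Real.log 2) / (R * Real.log 2) + 1) * (ν * Real.exp (-ν)) *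
      ((1 + s) * (1 - κ)) with hc'
    have hlim : Tendsto (fun n : ℕ => -((A' - θ) / 2) * Real.log n + c') atTop atBot :=
      tendsto_atBot_add_const_right _ _
        (tendsto_log_natCast.const_mul_atTop_of_neg (by linarith))
    refine tendsto_atBot_mono' _ ?_ hlim
    filter_upwards [h.log_le, mul_log_sub_le_testCount h hR, eventually_ge_atTop 1] with n h1 h2 hn
    have hL : 0 ≤ Real.log n := Real.log_natCast_nonneg n
    have hm : 0 ≤ ν * Real.exp (-ν) * ((1 + s) * (1 - κ)) :=
      mul_nonneg (by positivity) (mul_nonneg (by linarith) (by linarith))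
    have h3 := mul_le_mul_of_nonneg_right h2 hm
    have h4 : (1 - θ) / (R * Real.log 2) * Real.log n * (ν * Real.exp (-ν) * ((1 + s) * (1 - κ))) =
        A' * (1 + s) * Real.log n := by
      have : A * (1 - κ) = A' := by rw [hκ]; field_simp; ring
      rw [← this, hAdef]
      ring
    have h5 : θ + s - A' * (1 + s) ≤ -((A' - θ) / 2) := by nlinarith
    have h6 := mul_le_mul_of_nonneg_right h5 hL
    rw [sub_mul, h4] at h3
    have h7 : testCount k R n / k n * (ν * Real.exp (-ν)) * ((1 + s) * (1 - κ)) =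
      testCount k R n / k n * (ν * Real.exp (-ν) * ((1 + s) * (1 - κ))) := by ring
    rw [h7, hc']
    linarith
  · filter_upwards [h.one_le, h.two_mul_le] with n h1 h2 l hl hlk hx
    have hl0 : (0 : ℝ) < l := by positivity
    have hk0 : (0 : ℝ) < k n := by exact_mod_cast h1
    exact swapBound_le_pow h1 (by omega) hl hlk hν hs0.le hs1 (hδκ _ (by positivity) hx) hκ1

end achievability

/-! ### Exchanges of many defectives, masked defectives, and achievability. -/

section achievability

variable {θ c R ν : ℝ} {k : ℕ → ℕ}

/-- The gap between the entropy and H' pays for the quadratic error s² of the expansion. -/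
theorem mul_le_exponent {α s H' : ℝ} (hν : 0 ≤ ν) (hα0 : 0 ≤ α) (hα1 : α ≤ 1) (hs : 0 ≤ s)
    (hsH : s ≤ α * (Real.binEntropy (Real.exp (-ν)) - H')) :
    s * α * H' ≤ Real.exp (-(ν * (1 - α))) *
      (1 - Real.exp (-(ν * α)) ^ (1 + s) - (1 - Real.exp (-(ν * α))) ^ (1 + s)) := by
  have hu1 : Real.exp (-(ν * α)) ≤ 1 := Real.exp_le_one_iff.2 (neg_nonpos.2 (mul_nonneg hν hα0))
  have hw0 := (Real.exp_pos (-(ν * (1 - α)))).le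
  have hw1 : Real.exp (-(ν * (1 - α))) ≤ 1 :=
    Real.exp_le_one_iff.2 (neg_nonpos.2 (mul_nonneg hν (sub_nonneg.2 hα1)))
  have e1 := mul_le_mul_of_nonneg_left
    (mul_binEntropy_sub_le (Real.exp_pos (-(ν * α))).le hu1 hs) hw0
  have e2 := mul_le_mul_of_nonneg_left (mul_binEntropy_le hν hα0 hα1) hs
  have e3 := mul_le_mul_of_nonneg_right hw1 (sq_nonneg s)
  have e4 := mul_le_mul_of_nonneg_left hsH hs
  refine le_trans ?_ e1
  linarith

/-- The number of choices of `M` costs about sαKΛ and the tests gain sαKBΛ. The net gain is at least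
sεK(B - 1)Λ, up to terms of order K. -/
theorem large_swap_exponent_le {K T s α ε B H' Λ R' : ℝ} (hK : 1 ≤ K) (hs : 0 ≤ s) (hα0 : 0 ≤ α)
    (hα1 : α ≤ 1) (hεα : ε ≤ α) (hR' : 0 < R') (hH' : 0 ≤ H') (hB1 : 1 ≤ B) (hB : B = H' / R')
    (hΛ : 0 ≤ Λ) (hT : K * ((Λ - Real.log 2) / R') - 1 ≤ T) :
    K * Real.log 2 + (s * (α * K) * (1 + Λ - Real.log ε) + -(T * (s * α * H'))) ≤
      K * (Real.log 2 + s * |1 - Real.log ε + B * Real.log 2| + s * H' - s * ε * (B - 1) * Λ) := by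
  set d := 1 - Real.log ε + B * Real.log 2 with hd
  have e1 := mul_le_mul_of_nonneg_right hT (show 0 ≤ s * α * H' by positivity)
  have e2 : (K * ((Λ - Real.log 2) / R') - 1) * (s * α * H') =
      s * α * K * (B * (Λ - Real.log 2)) - s * α * H' := by
    rw [hB]; field_simp
  rw [e2] at e1
  have e3 : s * α * H' ≤ K * (s * H') := by
    calc s * α * H' = α * (s * H') := by ring
      _ ≤ K * (s * H') := by gcongr; linarith
  have e4 : s * K * (α * (-((B - 1) * Λ) + d)) ≤ s * K * (-(ε * ((B - 1) * Λ)) + |d|) := by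
    have f1 : 0 ≤ (B - 1) * Λ := mul_nonneg (by linarith) hΛ
    have f2 : α * d ≤ |d| := by nlinarith [le_abs_self d, abs_nonneg d]
    have f3 := mul_le_mul_of_nonneg_right hεα f1
    refine mul_le_mul_of_nonneg_left ?_ (by positivity)
    linarith
  have e5 : s * K * (α * (-((B - 1) * Λ) + d)) = s * (α * K) * (1 + Λ - Real.log ε) -
      s * α * K * (B * (Λ - Real.log 2)) := by rw [hd]; ring
  rw [e5] at e4
  linarith

/-- Exchanges of a positive proportion of the defectives. -/
theorem exists_large_swap (h : SparseBounds θ k c) (hθ : θ < 1) (hR : 0 < R) (hν : 0 < ν)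
    (hH : R * Real.log 2 < Real.binEntropy (Real.exp (-ν))) {δ : ℝ} (hδ : 0 < δ) :
    ∃ s : ℝ, 0 ≤ s ∧ s ≤ 1 ∧ ∃ C γ : ℝ, 0 < γ ∧
      ∀ᶠ n : ℕ in atTop, ∀ l, 1 ≤ l → l ≤ k n → δ < ν * (l / k n) →
        swapBound n (testCount k R n) (k n) (1 - Real.exp (-(ν / k n))) l s ≤
          Real.exp (k n * (C - γ * Real.log (n / k n))) := by
  have hl2 : 0 < Real.log 2 := Real.log_pos one_lt_two
  have hRl : 0 < R * Real.log 2 := mul_pos hR hl2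
  set H := Real.binEntropy (Real.exp (-ν)) with hHdef
  set ε := δ / ν with hε
  have hε0 : 0 < ε := div_pos hδ hν
  -- H' is strictly between R log 2 and H: the gap above allows a positive s, the gap below makes B
  -- > 1.
  set H' := (H + R * Real.log 2) / 2 with hH'
  set B := H' / (R * Real.log 2) with hB
  have hB1 : 1 < B := by rw [hB, one_lt_div hRl]; linarith
  have hBH : B * (R * Real.log 2) = H' := div_mul_cancel₀ _ hRl.ne'
  set s := min 1 (ε * (H - H')) with hs
  have hs0 : 0 < s := lt_min one_pos (mul_pos hε0 (by linarith))
  have hs1 : s ≤ 1 := min_le_left _ _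
  have hs2 : s ≤ ε * (H - H') := min_le_right _ _
  set d := 1 - Real.log ε + B * Real.log 2 with hd
  refine ⟨s, hs0.le, hs1, Real.log 2 + s * |d| + s * H', s * ε * (B - 1),
    mul_pos (mul_pos hs0 hε0) (by linarith), ?_⟩
  filter_upwards [h.one_le, h.two_mul_le, le_testCount h hR,
    (h.tendsto_log_div hθ).eventually_ge_atTop 0] with n h1 h2 hT hΛ l hl hlk hx
  have hk1 : (1 : ℝ) ≤ k n := by exact_mod_cast h1
  have hk0 : (0 : ℝ) < k n := by linarith
  have hl0 : (0 : ℝ) < l := by positivity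
  have hn0 : (0 : ℝ) < n := by exact_mod_cast (by omega : 0 < n)
  set α : ℝ := l / k n with hα
  set Λ := Real.log (n / k n) with hΛdef
  set T := testCount k R n
  have hα0 : 0 < α := by positivity
  have hα1 : α ≤ 1 := by rw [hα, div_le_one hk0]; exact_mod_cast hlk
  have hεα : ε ≤ α := by rw [hε, div_le_iff₀ hν]; linarith
  have hG := mul_le_exponent hν.le hα0.le hα1 hs0.le (hs2.trans
    (mul_le_mul_of_nonneg_right hεα (show 0 ≤ H - H' by linarith)))
  have hc1 : ((k n).choose l : ℝ) ≤ Real.exp (k n * Real.log 2) := by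
    rw [mul_comm, Real.exp_mul, Real.exp_log two_pos, Real.rpow_natCast]
    exact_mod_cast Nat.choose_le_two_pow (k n) l
  have hc2 : ((n - k n).choose l : ℝ) ^ s ≤ Real.exp (s * (α * k n) * (1 + Λ - Real.log ε)) := by
    have e1 : ((n - k n).choose l : ℝ) ≤ Real.exp (l * (1 + Λ - Real.log ε)) := by
      calc ((n - k n).choose l : ℝ) ≤ n.choose l := by
            exact_mod_cast Nat.choose_le_choose l (Nat.sub_le n (k n))
        _ ≤ (Real.exp 1 * n / l) ^ l := choose_le_exp_mul_div_pow hl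
        _ ≤ (Real.exp (1 + Λ - Real.log ε)) ^ l := by
            refine pow_le_pow_left₀ (by positivity) ?_ l
            rw [Real.exp_sub, Real.exp_add, Real.exp_log hε0, Real.exp_log (by positivity)]
            rw [div_le_div_iff₀ hl0 hε0]
            have : ε * k n ≤ l := by
              calc ε * k n ≤ α * k n := by gcongr
                _ = l := by rw [hα]; field_simp
            calc Real.exp 1 * n * ε = Real.exp 1 * (n / k n) * (ε * k n) := by field_simp
              _ ≤ Real.exp 1 * (n / k n) * l := by gcongr
        _ = _ := by rw [← Real.exp_nat_mul]
    refine (Real.rpow_le_rpow (Nat.cast_nonneg _) e1 hs0.le).trans (le_of_eq ?_)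
    rw [← Real.exp_mul]
    congr 1
    rw [hα]
    field_simp
  refine (swapBound_le h1 hlk hν).trans ?_
  calc _ ≤ Real.exp (k n * Real.log 2) * (Real.exp (s * (α * k n) * (1 + Λ - Real.log ε)) *
        Real.exp (-(T * (s * α * H')))) := by
        refine mul_le_mul hc1 (mul_le_mul hc2 ?_ (Real.exp_pos _).le (Real.exp_pos _).le)
          (mul_nonneg (Real.rpow_nonneg (Nat.cast_nonneg _) s) (Real.exp_pos _).le)
          (Real.exp_pos _).le
        rw [Real.exp_le_exp, neg_le_neg_iff]
        exact mul_le_mul_of_nonneg_left hG (Nat.cast_nonneg _)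
    _ ≤ _ := by
      rw [← Real.exp_add, ← Real.exp_add, Real.exp_le_exp]
      exact large_swap_exponent_le hk1 hs0.le hα0.le hα1 hεα hRl (by linarith) hB1.le hB hΛ hT

/-- The chance that a given defective is alone in a test is e^{-ν}(e^{ν/k} - 1) ≥ e^{-ν}ν/k. -/
theorem masked_le {k T : ℕ} (hk : 1 ≤ k) (hν : 0 < ν) :
    k * (1 - ((1 - (1 - Real.exp (-(ν / k)))) ^ (k - 1) - (1 - (1 - Real.exp (-(ν / k)))) ^ k)) ^ T ≤
      Real.exp (Real.log k - T / k * (ν * Real.exp (-ν))) := by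
  have hk0 : (0 : ℝ) < k := by positivity
  rw [one_sub_pow_eq_exp, one_sub_pow_eq_exp, div_self hk0.ne', mul_one, Nat.cast_sub hk]
  set a := Real.exp (-(ν * (((k : ℝ) - (1 : ℕ)) / k))) - Real.exp (-ν) with ha
  have ha1 : a ≤ 1 := by
    have : Real.exp (-(ν * (((k : ℝ) - (1 : ℕ)) / k))) ≤ 1 := by
      rw [Real.exp_le_one_iff, neg_nonpos]
      have : (1 : ℝ) ≤ k := by exact_mod_cast hk
      push_cast
      have : 0 ≤ (k : ℝ) - 1 := by linarith
      positivity
    linarith [Real.exp_pos (-ν)]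
  have ha2 : Real.exp (-ν) * (ν / k) ≤ a := by
    have e : Real.exp (-(ν * (((k : ℝ) - (1 : ℕ)) / k))) = Real.exp (-ν) * Real.exp (ν / k) := by
      rw [← Real.exp_add]; congr 1; push_cast; field_simp; ring
    rw [ha, e]
    nlinarith [Real.add_one_le_exp (ν / k), Real.exp_pos (-ν)]
  calc (k : ℝ) * (1 - a) ^ T ≤ k * Real.exp (-(Real.exp (-ν) * (ν / k))) ^ T := by
        have : 1 - a ≤ Real.exp (-(Real.exp (-ν) * (ν / k))) := by
          linarith [Real.add_one_le_exp (-(Real.exp (-ν) * (ν / k)))]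
        have h0 : 0 ≤ 1 - a := by linarith
        gcongr
    _ = _ := by
        rw [← Real.exp_nat_mul, sub_eq_add_neg, Real.exp_add, Real.exp_log hk0]
        congr 2
        field_simp

theorem tendsto_masked (h : SparseBounds θ k c) (hR : 0 < R)
    (hν : 0 < ν) (hA : θ < ν * Real.exp (-ν) * (1 - θ) / (R * Real.log 2)) :
    Tendsto (fun n : ℕ => Real.exp (Real.log (k n) -
      testCount k R n / k n * (ν * Real.exp (-ν)))) atTop (𝓝 0) := by
  refine Real.tendsto_exp_atBot.comp ?_
  set A := ν * Real.exp (-ν) * (1 - θ) / (R * Real.log 2) with hAdef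
  have hlim : Tendsto (fun n : ℕ => (θ - A) * Real.log n +
      (c + ((c + Real.log 2) / (R * Real.log 2) + 1) * (ν * Real.exp (-ν)))) atTop atBot :=
    tendsto_atBot_add_const_right _ _
      (tendsto_log_natCast.const_mul_atTop_of_neg (by linarith))
  refine tendsto_atBot_mono' _ ?_ hlim
  filter_upwards [h.log_le, mul_log_sub_le_testCount h hR] with n h1 h2
  have h3 := mul_le_mul_of_nonneg_right h2 (show 0 ≤ ν * Real.exp (-ν) by positivity)
  have h4 : (1 - θ) / (R * Real.log 2) * Real.log n * (ν * Real.exp (-ν)) = A * Real.log n := by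
    rw [hAdef]; ring
  rw [sub_mul, h4] at h3
  linarith

theorem sum_pow_le {r : ℝ} (h0 : 0 ≤ r) (h1 : r ≤ 1 / 2) (k : ℕ) :
    ∑ l ∈ Finset.Icc 1 k, r ^ l ≤ 2 * r := by
  have h2 : ∑ l ∈ Finset.Icc 1 k, r ^ l ≤ ∑ l ∈ Finset.Icc 1 k, 2 * r * (1 / 2) ^ l := by
    refine Finset.sum_le_sum fun l hl => ?_
    obtain ⟨m, rfl⟩ : ∃ m, l = m + 1 := ⟨l - 1, by have := (Finset.mem_Icc.1 hl).1; omega⟩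
    calc r ^ (m + 1) = r * r ^ m := by ring
      _ ≤ r * (1 / 2) ^ m := by gcongr
      _ = _ := by ring
  have h3 : ∀ k : ℕ, ∑ l ∈ Finset.Icc 1 k, ((1 : ℝ) / 2) ^ l ≤ 1 := by
    intro k
    have : ∀ k : ℕ, ∑ l ∈ Finset.Icc 1 k, ((1 : ℝ) / 2) ^ l = 1 - (1 / 2) ^ k := by
      intro k
      induction k with
      | zero => simp
      | succ k ih => rw [Finset.sum_Icc_succ_top (by omega), ih]; ring
    rw [this]
    have : (0 : ℝ) ≤ (1 / 2) ^ k := by positivity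
    linarith
  refine h2.trans ?_
  rw [← Finset.mul_sum]
  nlinarith [h3 k]

theorem errorProb_nonneg {n T : ℕ} {p : ℝ} (h0 : 0 ≤ p) (h1 : p ≤ 1) (k : ℕ) (D : Detector n T) :
    0 ≤ errorProb p k D := by
  rw [errorProb_eq]
  exact mul_nonneg (by positivity) (Finset.sum_nonneg fun K _ =>
    designExp_nonneg h0 h1 fun X => ind_nonneg _)

/-- Achievability: smallest-satisfying-set decoding works at the rate `R` when the parameter `ν`
satisfies the masking and the entropy condition. -/
theorem achievesRate_of_lt {S : ∀ n T, Detector n T} (hS : ∀ n T, IsSSS (S n T))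
    (h : SparseBounds θ k c) (h0 : 0 ≤ θ) (hθ : θ < 1) (hR : 0 < R) (hν : 0 < ν)
    (hA : θ < ν * Real.exp (-ν) * (1 - θ) / (R * Real.log 2))
    (hH : R * Real.log 2 < Real.binEntropy (Real.exp (-ν))) : AchievesRate k S R := by
  have hp : ∀ n, 0 ≤ 1 - Real.exp (-(ν / k n)) ∧ 1 - Real.exp (-(ν / k n)) ≤ 1 := fun n =>
    ⟨sub_nonneg.2 (Real.exp_le_one_iff.2 (neg_nonpos.2 (by positivity))),
      sub_le_self _ (Real.exp_pos _).le⟩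
  refine ⟨hR, testCount k R, fun n => 1 - Real.exp (-(ν / k n)), hp,
    Eventually.of_forall (testCount_le hR), ?_⟩
  obtain ⟨δ, hδ, s₁, hs₁0, hs₁1, r, hr, hr0, hsmall⟩ := exists_small_swap h hR hν hA h0
  obtain ⟨s₂, hs₂0, hs₂1, C, γ, hγ, hlarge⟩ := exists_large_swap h hθ hR hν hH hδ
  have hE : Tendsto (fun n : ℕ => 1 + C - γ * Real.log (n / k n)) atTop atBot := by
    simp only [sub_eq_add_neg, ← neg_mul]
    exact tendsto_atBot_add_const_left _ _
      ((h.tendsto_log_div hθ).const_mul_atTop_of_neg (neg_neg_of_pos hγ))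
  have hlim := ((tendsto_masked h hR hν hA).add (hr.const_mul 2)).add (Real.tendsto_exp_atBot.comp hE)
  simp only [mul_zero, add_zero] at hlim
  refine tendsto_of_tendsto_of_tendsto_of_le_of_le' tendsto_const_nhds hlim
    (Eventually.of_forall fun n => errorProb_nonneg (hp n).1 (hp n).2 _ _) ?_
  filter_upwards [h.one_le, h.two_mul_le, hsmall, hlarge, hE.eventually_le_atBot 0,
    hr.eventually_le_const (show (0 : ℝ) < 1 / 2 by norm_num)] with n h1 h2 h3 h4 h5 h6
  have hk1 : (1 : ℝ) ≤ k n := by exact_mod_cast h1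
  have hbound := (hS n (testCount k R n)).errorProb_le (hp n).1 (hp n).2 (k := k n) (by omega)
    (s := fun l => if ν * (l / k n) ≤ δ then s₁ else s₂) (fun l => by split_ifs <;> assumption)
    (fun l => by split_ifs <;> assumption)
  refine hbound.trans ?_
  rw [add_assoc]
  refine add_le_add (masked_le h1 hν) ?_
  have hterm : ∀ l ∈ Finset.Icc 1 (k n),
      swapBound n (testCount k R n) (k n) (1 - Real.exp (-(ν / k n))) l
        (if ν * (l / k n) ≤ δ then s₁ else s₂) ≤
      r n ^ l + Real.exp (k n * (C - γ * Real.log (n / k n))) := by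
    intro l hl
    rw [Finset.mem_Icc] at hl
    split_ifs with hx
    · exact (h3 l hl.1 hl.2 hx).trans (le_add_of_nonneg_right (Real.exp_pos _).le)
    · exact (h4 l hl.1 hl.2 (not_le.1 hx)).trans (le_add_of_nonneg_left (pow_nonneg (hr0 n) l))
  refine (Finset.sum_le_sum hterm).trans ?_
  rw [Finset.sum_add_distrib]
  refine add_le_add (sum_pow_le (hr0 n) h6 _) ?_
  rw [Finset.sum_const, Nat.card_Icc, Nat.add_sub_cancel, nsmul_eq_mul]
  -- The number k of summands is absorbed by e^k. The new exponent factor is nonpositive, so k ≥ 1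
  -- may then be dropped.
  calc (k n : ℝ) * Real.exp (k n * (C - γ * Real.log (n / k n)))
      ≤ Real.exp (k n) * Real.exp (k n * (C - γ * Real.log (n / k n))) := by
        gcongr
        linarith [Real.add_one_le_exp (k n : ℝ)]
    _ = Real.exp (k n * (1 + C - γ * Real.log (n / k n))) := by
        rw [← Real.exp_add]; congr 1; ring
    _ ≤ Real.exp (1 + C - γ * Real.log (n / k n)) := by
        rw [Real.exp_le_exp]; nlinarith

theorem achievesRate_of_lt_capacity {S : ∀ n T, Detector n T} (hS : ∀ n T, IsSSS (S n T))
    (h : SparseBounds θ k c) (h0 : 0 ≤ θ) (hθ : θ < 1) (hR : 0 < R) (hC : R < capacity θ) :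
    AchievesRate k S R := by
  have hl2 : 0 < Real.log 2 := Real.log_pos one_lt_two
  obtain ⟨ν, hν, hνC⟩ := (isGreatest_capacity h0 hθ).1
  rw [Set.mem_Ioi] at hν
  rw [← hνC, capacityTerm] at hC
  split_ifs at hC with hz
  · refine achievesRate_of_lt hS h h0 hθ hR hν ?_ ?_
    · rw [hz]; simp only [sub_zero, mul_one]; positivity
    · rwa [GroupTesting.h, lt_div_iff₀ hl2] at hC
  · rw [lt_min_iff] at hC
    have hθ0 : 0 < θ := lt_of_le_of_ne h0 (Ne.symm hz)
    refine achievesRate_of_lt hS h h0 hθ hR hν ?_ ?_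
    · have := hC.1
      rw [div_mul_div_comm, lt_div_iff₀ (by positivity)] at this
      rw [lt_div_iff₀ (by positivity)]
      linarith
    · have := hC.2
      rwa [GroupTesting.h, lt_div_iff₀ hl2] at this

end achievability

/-! ### Asymptotic converse: low entropy, or masked and hidden items. -/

section converse

variable {θ c R : ℝ} {k : ℕ → ℕ}

theorem capacity_pos (h0 : 0 ≤ θ) (hθ : θ < 1) : 0 < capacity θ := by
  have hl2 : 0 < Real.log 2 := Real.log_pos one_lt_two
  have hh : 0 < h (Real.exp (-1)) :=
    div_pos (Real.binEntropy_pos (Real.exp_pos _) (by simp)) hl2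
  refine lt_of_lt_of_le ?_ ((isGreatest_capacity h0 hθ).2 ⟨1, Set.mem_Ioi.2 one_pos, rfl⟩)
  unfold capacityTerm
  split_ifs with hz
  · exact hh
  · have : 0 < θ := lt_of_le_of_ne h0 (Ne.symm hz)
    have h2 : 0 < 1 - θ := by linarith
    exact lt_min (by positivity) hh

/-- Low entropy of the outcomes makes every detector fail. -/
theorem exists_success_le (h : SparseBounds θ k c) (hθ : θ < 1) {C : ℝ} (hR : 0 < R) (hCR : C < R) :
    ∃ g : ℕ → ℝ, Tendsto g atTop (𝓝 0) ∧ ∀ᶠ n : ℕ in atTop, ∀ (T : ℕ) (p : ℝ) (D : Detector n T),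
      0 ≤ p → p ≤ 1 → (T : ℝ) ≤ Real.logb 2 (n.choose (k n)) / R →
      Real.binEntropy ((1 - p) ^ k n) ≤ C * Real.log 2 → 1 - errorProb p (k n) D ≤ g n := by
  have hl2 : 0 < Real.log 2 := Real.log_pos one_lt_two
  have hRl : 0 < R * Real.log 2 := mul_pos hR hl2
  -- C/R = 1 - 4η. The threshold τ = e^{-(1-η)M} makes the first error term e^{-ηM}. The choice of s
  -- keeps the quadratic error within one more η, so the second exponent is at most s(1 - 3η)M - s(1
  -- - η)M = -2ηsM.
  set η := (1 - C / R) / 4 with hη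
  have hη0 : 0 < η := by
    have : C / R < 1 := (div_lt_one hR).2 hCR
    rw [hη]; linarith
  set s := min (1 / 2) (η * (R * Real.log 2) / 8) with hs
  have hs0 : 0 < s := lt_min (by norm_num) (by positivity)
  have hs1 : s ≤ 1 / 2 := min_le_left _ _
  have hs2 : s ≤ η * (R * Real.log 2) / 8 := min_le_right _ _
  have hM := h.tendsto_log_choose hθ
  refine ⟨fun n => Real.exp (-η * Real.log (n.choose (k n))) +
    Real.exp (-(2 * η * s) * Real.log (n.choose (k n))), ?_, ?_⟩
  · rw [← add_zero (0 : ℝ)]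
    exact (Real.tendsto_exp_atBot.comp (hM.const_mul_atTop_of_neg (by linarith))).add
      (Real.tendsto_exp_atBot.comp (hM.const_mul_atTop_of_neg
        (neg_neg_of_pos (by positivity))))
  · filter_upwards [h.two_mul_le] with n h2 T p D hp0 hp1 hT hH
    have hkn : k n ≤ n := by omega
    have hN : (0 : ℝ) < n.choose (k n) := Nat.cast_pos.2 (Nat.choose_pos hkn)
    set M := Real.log (n.choose (k n)) with hMdef
    have hM0 : 0 ≤ M := Real.log_natCast_nonneg _
    have hq0 : 0 ≤ (1 - p) ^ k n := pow_nonneg (by linarith) _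
    have hq1 : (1 - p) ^ k n ≤ 1 := pow_le_one₀ (by linarith) (by linarith)
    have hmain := one_sub_errorProb_le hp0 hp1 hkn D (τ := Real.exp (-((1 - η) * M))) (Real.exp_pos _)
      hs0.le
    refine hmain.trans (add_le_add (le_of_eq ?_) ?_)
    · rw [← Real.exp_log hN, ← hMdef, ← Real.exp_add, one_div, ← Real.exp_neg]
      congr 1
      ring
    · have hpow := pow_le_pow_left₀ (add_nonneg (Real.rpow_nonneg hq0 _)
        (Real.rpow_nonneg (by linarith) _)) (rpow_one_sub_add_le hq0 hq1 hs0.le hs1) T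
      rw [← Real.exp_nat_mul] at hpow
      refine (mul_le_mul_of_nonneg_left hpow (Real.rpow_nonneg (Real.exp_pos _).le s)).trans ?_
      rw [← Real.exp_mul, ← Real.exp_add, Real.exp_le_exp]
      rw [Real.logb, div_div, le_div_iff₀ (by positivity)] at hT
      have e1 : s * Real.binEntropy ((1 - p) ^ k n) + 8 * s ^ 2 ≤
          s * (C / R + η) * (R * Real.log 2) := by
        have e2 := mul_le_mul_of_nonneg_left hH hs0.le
        have e3 := mul_le_mul_of_nonneg_left hs2 hs0.le
        have e4 : s * (C / R + η) * (R * Real.log 2) =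
          s * (C * Real.log 2) + s * (η * (R * Real.log 2) / 8) * 8 := by field_simp
        rw [e4]
        nlinarith
      have e5 := mul_le_mul_of_nonneg_left e1 (Nat.cast_nonneg (α := ℝ) T)
      have hCη : C / R = 1 - 4 * η := by rw [hη]; ring
      rw [hCη] at e5
      have e6 : T * (s * (1 - 4 * η + η) * (R * Real.log 2)) ≤ s * (1 - 3 * η) * M := by
        have hnn : 0 ≤ s * (1 - 4 * η + η) * (R * Real.log 2) := by
          refine le_trans ?_ (hCη ▸ e1)
          have := Real.binEntropy_nonneg hq0 hq1
          positivity
        have hnn' : 0 ≤ s * (1 - 3 * η) := by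
          have := nonneg_of_mul_nonneg_left hnn hRl
          linarith
        calc T * (s * (1 - 4 * η + η) * (R * Real.log 2))
            = s * (1 - 3 * η) * (T * (Real.log 2 * R)) := by ring
          _ ≤ s * (1 - 3 * η) * M := by gcongr
      linarith

theorem mul_exp_neg_le_one (x : ℝ) : x * Real.exp (-x) ≤ 1 := by
  rw [Real.exp_neg, ← div_eq_mul_inv, div_le_one (Real.exp_pos x)]
  linarith [Real.add_one_le_exp x]

theorem one_sub_pow_le_exp {p : ℝ} (h1 : p ≤ 1) (k : ℕ) : (1 - p) ^ k ≤ Real.exp (-(k * p)) := by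
  have : 1 - p ≤ Real.exp (-p) := by linarith [Real.add_one_le_exp (-p)]
  calc (1 - p) ^ k ≤ Real.exp (-p) ^ k := pow_le_pow_left₀ (by linarith) this k
    _ = _ := by rw [← Real.exp_nat_mul]; congr 1; ring

theorem mul_pow_pred_le {p : ℝ} (h0 : 0 ≤ p) (h1 : p ≤ 1) {k : ℕ} (hk : 2 ≤ k) :
    p * (1 - p) ^ (k - 1) ≤ 1 / ((k - 1 : ℕ) : ℝ) := by
  have hk0 : (0 : ℝ) < (k - 1 : ℕ) := Nat.cast_pos.2 (by omega)
  rw [le_div_iff₀ hk0]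
  calc p * (1 - p) ^ (k - 1) * (k - 1 : ℕ) ≤ p * Real.exp (-((k - 1 : ℕ) * p)) * (k - 1 : ℕ) := by
        gcongr; exact one_sub_pow_le_exp h1 _
    _ = ((k - 1 : ℕ) * p) * Real.exp (-((k - 1 : ℕ) * p)) := by ring
    _ ≤ 1 := mul_exp_neg_le_one _

/-- The odds that a defective item is alone among the defectives in a test, in terms of the
probability that a test with no other defectives contains a given item. -/
theorem eventually_mul_odds_le {Q ε : ℝ} (hQ : 0 < Q) (hε : 0 < ε) (hε1 : ε < 1) :
    ∀ᶠ k : ℕ in atTop, ∀ p : ℝ, 0 ≤ p → p < 1 → k * (p * (1 - p) ^ k) ≤ Q →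
      p * (1 - p) ^ (k - 1) < 1 / 2 ∧
      k * (p * (1 - p) ^ (k - 1) / (1 - p * (1 - p) ^ (k - 1))) ≤ Q / (1 - ε) ^ 2 := by
  have hpow := (tendsto_self_mul_const_pow_of_lt_one (r := 1 - ε) (by linarith)
    (by linarith)).eventually_le_const (show (0 : ℝ) < Q * (1 - ε) / 2 by
      have : 0 < 1 - ε := by linarith
      positivity)
  have hinv : ∀ᶠ k : ℕ in atTop, 1 / ((k - 1 : ℕ) : ℝ) < min ε (1 / 2) := by
    have : Tendsto (fun k : ℕ => 1 / ((k - 1 : ℕ) : ℝ)) atTop (𝓝 0) :=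
      tendsto_one_div_atTop_nhds_zero_nat.comp (tendsto_sub_atTop_nat 1)
    exact this.eventually_lt_const (lt_min hε (by norm_num))
  filter_upwards [hpow, hinv, eventually_ge_atTop 2] with k h1 h2 hk p hp0 hp1 hQk
  have h1ε : 0 < 1 - ε := by linarith
  have hk0 : (0 : ℝ) < k := by positivity
  rw [lt_min_iff] at h2
  obtain ⟨m, rfl⟩ : ∃ m, k = m + 1 := ⟨k - 1, by omega⟩
  have ha := mul_pow_pred_le hp0 hp1.le hk
  simp only [Nat.add_sub_cancel] at ha h2 ⊢
  set a := p * (1 - p) ^ m with hadef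
  have ha0 : 0 ≤ a := by have : 0 ≤ 1 - p := by linarith
                         positivity
  refine ⟨by linarith, ?_⟩
  -- p need not be of order 1/k. For p ≤ ε, both 1 - p and 1 - a are at least 1 - ε; for p > ε, ka
  -- is exponentially small.
  rcases le_or_gt p ε with hpe | hpe
  · rw [← mul_div_assoc, div_le_div_iff₀ (by linarith) (by positivity)]
    have e1 : (1 - ε) ≤ 1 - a := by linarith
    have e2 : (↑(m + 1) : ℝ) * a * (1 - ε) ≤ Q := by
      calc (↑(m + 1) : ℝ) * a * (1 - ε) ≤ ↑(m + 1) * a * (1 - p) := by gcongr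
        _ = ↑(m + 1) * (p * (1 - p) ^ (m + 1)) := by rw [hadef]; ring
        _ ≤ Q := hQk
    calc (↑(m + 1) : ℝ) * a * (1 - ε) ^ 2 = ↑(m + 1) * a * (1 - ε) * (1 - ε) := by ring
      _ ≤ Q * (1 - a) := mul_le_mul e2 e1 h1ε.le hQ.le
  · have e1 : a ≤ (1 - ε) ^ m := by
      calc a ≤ 1 * (1 - p) ^ m := by
            rw [hadef]; have : 0 ≤ 1 - p := by linarith
            gcongr
        _ ≤ (1 - ε) ^ m := by
            rw [one_mul]; exact pow_le_pow_left₀ (by linarith) (by linarith) m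
    have e2 : (↑(m + 1) : ℝ) * (1 - ε) ^ m ≤ Q / 2 := by
      rw [pow_succ, ← mul_assoc] at h1
      nlinarith
    have e3 : a / (1 - a) ≤ 2 * a := by
      rw [div_le_iff₀ (by linarith)]; nlinarith
    have e4 : Q ≤ Q / (1 - ε) ^ 2 := by
      rw [le_div_iff₀ (by positivity)]
      have : (1 - ε) ^ 2 ≤ 1 := pow_le_one₀ h1ε.le (by linarith)
      nlinarith
    calc (↑(m + 1) : ℝ) * (a / (1 - a)) ≤ ↑(m + 1) * (2 * (1 - ε) ^ m) := by
          gcongr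
          linarith
      _ ≤ Q := by linarith
      _ ≤ _ := e4

theorem SparseBounds.tendsto_atTop (h : SparseBounds θ k c) (h0 : 0 < θ) : Tendsto k atTop atTop := by
  have hlog : Tendsto (fun n : ℕ => Real.log (k n)) atTop atTop :=
    tendsto_atTop_mono' _ h.le_log (tendsto_atTop_add_const_right _ (-c)
      (tendsto_log_natCast.const_mul_atTop h0))
  refine (tendsto_natCast_atTop_iff (R := ℝ)).1 (tendsto_atTop_mono' _ ?_ hlog)
  filter_upwards [h.one_le] with n hn
  have : (0 : ℝ) < k n := by exact_mod_cast hn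
  linarith [Real.log_le_sub_one_of_pos this]

/-- log(1 - a) ≥ -a/(1 - a); this is why odds appear in the masking estimate. -/
theorem exp_neg_le_pow {a : ℝ} (ha : a < 1) (T : ℕ) :
    Real.exp (-(T * (a / (1 - a)))) ≤ (1 - a) ^ T := by
  have h1 : 0 < 1 - a := by linarith
  have h2 := Real.one_sub_inv_le_log_of_pos h1
  have h3 : 1 - (1 - a)⁻¹ = -(a / (1 - a)) := by field_simp; ring
  rw [← Real.exp_log (pow_pos h1 T), Real.exp_le_exp, Real.log_pow, ← mul_neg, ← h3]
  gcongr

/-- Masked defectives and hidden non-defectives make every detector fail. -/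
theorem eventually_quarter_le_errorProb (h : SparseBounds θ k c) (h0 : 0 < θ) (hθ : θ < 1) {C : ℝ}
    (hC : 0 < C) (hCR : C < R) :
    ∀ᶠ n : ℕ in atTop, ∀ (T : ℕ) (p : ℝ) (D : Detector n T), 0 ≤ p → p < 1 →
      (T : ℝ) ≤ Real.logb 2 (n.choose (k n)) / R →
      k n * (p * (1 - p) ^ k n) ≤ C * (θ * Real.log 2 / (1 - θ)) →
      1 / 4 ≤ errorProb p (k n) D := by
  have hl2 : 0 < Real.log 2 := Real.log_pos one_lt_two
  have hR : 0 < R := hC.trans hCR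
  have h1θ : 0 < 1 - θ := by linarith
  set Q := C * (θ * Real.log 2 / (1 - θ)) with hQ
  have hQ0 : 0 < Q := by positivity
  -- ρ lies midway between C/R and 1, leaving room for the factor (1 - ε)^{-2} lost in passing from
  -- b to the odds of a.
  set ρ := (1 + C / R) / 2 with hρ
  have hCR1 : C / R < 1 := (div_lt_one hR).2 hCR
  have hρ1 : ρ < 1 := by rw [hρ]; linarith
  have hρ0 : 0 < ρ := by have := div_pos hC hR
                         rw [hρ]; linarith
  obtain ⟨ε, hε, hε1, hερ⟩ : ∃ ε, 0 < ε ∧ ε < 1 ∧ C / R / (1 - ε) ^ 2 ≤ ρ := by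
    have hc : ContinuousAt (fun ε : ℝ => C / R / (1 - ε) ^ 2) 0 := by
      refine ContinuousAt.div (by fun_prop) (by fun_prop) (by norm_num)
    have ht : ∀ᶠ ε in 𝓝[>] (0 : ℝ), C / R / (1 - ε) ^ 2 < ρ := by
      refine (hc.eventually (gt_mem_nhds ?_)).filter_mono nhdsWithin_le_nhds
      simp only [sub_zero, one_pow, div_one]
      rw [hρ]; linarith
    obtain ⟨ε, hε1, hε2⟩ := (ht.and (Ioo_mem_nhdsGT (show (0 : ℝ) < 1 by norm_num))).exists
    exact ⟨ε, hε2.1, hε2.2, hε1.le⟩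
  have hk := h.tendsto_atTop h0
  -- This controls the correlation factor: T = O(k log k), using log n ≤ (log k + c)/θ, while bp ≤
  -- 1/k².
  have hlogk : ∀ᶠ n : ℕ in atTop, 4 / (R * Real.log 2) *
      (((1 - θ) * ((Real.log (k n) + c) / θ) + c + 1) / k n) ≤ Real.log (5 / 4) := by
    have h1 : Tendsto (fun x : ℝ => Real.log x / x) atTop (𝓝 0) :=
      Real.isLittleO_log_id_atTop.tendsto_div_nhds_zero
    have h2 : Tendsto (fun x : ℝ => 4 / (R * Real.log 2) *
        ((1 - θ) / θ * (Real.log x / x) + ((1 - θ) * c / θ + c + 1) * x⁻¹)) atTop (𝓝 0) := by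
      have := ((h1.const_mul ((1 - θ) / θ)).add
        (tendsto_inv_atTop_zero.const_mul ((1 - θ) * c / θ + c + 1))).const_mul (4 / (R * Real.log 2))
      simpa using this
    filter_upwards [(h2.comp (tendsto_natCast_atTop_atTop.comp hk)).eventually_le_const
      (Real.log_pos (by norm_num : (1 : ℝ) < 5 / 4))] with n hn
    refine le_trans (le_of_eq ?_) hn
    simp only [Function.comp]
    ring
  have hbig : ∀ᶠ n : ℕ in atTop, Real.log 8 ≤
      θ * (1 - ρ) * Real.log n - (c + ρ * (θ / (1 - θ)) * (c + 1)) :=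
    (tendsto_atTop_add_const_right _ (-(c + ρ * (θ / (1 - θ)) * (c + 1)))
      (tendsto_log_natCast.const_mul_atTop (mul_pos h0 (by linarith)))).eventually_ge_atTop _
  filter_upwards [hk.eventually (eventually_mul_odds_le hQ0 hε hε1), hk.eventually_ge_atTop 2,
    h.two_mul_le, h.le_log, h.log_div_le, hlogk, hbig, eventually_ge_atTop 1]
    with n hodds hk2 h2k hlog hΛ h4 h5 hn T p D hp0 hp1 hT hQk
  obtain ⟨ha2, hka⟩ := hodds p hp0 hp1 hQk
  have hk0 : (0 : ℝ) < k n := by positivity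
  have hL : 0 ≤ Real.log n := Real.log_natCast_nonneg n
  have h1p : 0 < 1 - p := by linarith
  have haeq : (1 - p) ^ (k n - 1) - (1 - p) ^ k n = p * (1 - p) ^ (k n - 1) := by
    obtain ⟨m, hm⟩ : ∃ m, k n = m + 1 := ⟨k n - 1, by omega⟩
    rw [hm, Nat.add_sub_cancel]; ring
  have hba : p * (1 - p) ^ k n ≤ p * (1 - p) ^ (k n - 1) :=
    mul_le_mul_of_nonneg_left (pow_le_pow_of_le_one h1p.le (by linarith) (by omega)) hp0
  set a := p * (1 - p) ^ (k n - 1) with ha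
  set b := p * (1 - p) ^ k n with hb
  have hb0 : 0 ≤ b := by positivity
  have ha0 : 0 ≤ a := hb0.trans hba
  have hTk : (T : ℝ) ≤ k n * (((1 - θ) * Real.log n + c + 1) / (R * Real.log 2)) := by
    refine hT.trans ?_
    rw [Real.logb, div_div, ← mul_div_assoc, mul_comm (Real.log 2)]
    have := log_choose_le (by omega : 1 ≤ k n) (by omega : k n ≤ n)
    gcongr
    refine this.trans ?_
    gcongr
  have hmask : 8 ≤ k n * (1 - a) ^ T := by
    have e1 : T * (a / (1 - a)) ≤ ρ * θ * Real.log n + ρ * (θ / (1 - θ)) * (c + 1) := by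
      have hnn : 0 ≤ a / (1 - a) := div_nonneg ha0 (by linarith)
      have hTn : 0 ≤ (1 - θ) * Real.log n + c + 1 := by
        have h6 : (0 : ℝ) ≤ T := Nat.cast_nonneg T
        by_contra hneg
        push Not at hneg
        have : k n * (((1 - θ) * Real.log n + c + 1) / (R * Real.log 2)) < 0 :=
          mul_neg_of_pos_of_neg hk0 (div_neg_of_neg_of_pos hneg (by positivity))
        linarith
      calc T * (a / (1 - a))
          ≤ k n * (((1 - θ) * Real.log n + c + 1) / (R * Real.log 2)) * (a / (1 - a)) := by gcongr
        _ = ((1 - θ) * Real.log n + c + 1) / (R * Real.log 2) * (k n * (a / (1 - a))) := by ring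
        _ ≤ ((1 - θ) * Real.log n + c + 1) / (R * Real.log 2) * (Q / (1 - ε) ^ 2) := by gcongr
        _ = (C / R / (1 - ε) ^ 2) * ((θ / (1 - θ)) * ((1 - θ) * Real.log n + c + 1)) := by
            rw [hQ]; field_simp
        _ ≤ ρ * ((θ / (1 - θ)) * ((1 - θ) * Real.log n + c + 1)) := by gcongr
        _ = _ := by field_simp; ring
    have e2 := exp_neg_le_pow (by linarith : a < 1) T
    calc (8 : ℝ) = Real.exp (Real.log 8) := (Real.exp_log (by norm_num)).symm
      _ ≤ Real.exp (Real.log (k n) + -(T * (a / (1 - a)))) := by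
          rw [Real.exp_le_exp]; linarith
      _ = k n * Real.exp (-(T * (a / (1 - a)))) := by rw [Real.exp_add, Real.exp_log hk0]
      _ ≤ _ := by gcongr
  -- Non-defectives outnumber defectives and b ≤ a, so hidden items are expected to be at least as
  -- numerous as masked ones.
  have hhid : 8 ≤ ((n - k n : ℕ) : ℝ) * (1 - b) ^ T := by
    refine hmask.trans ?_
    have e1 : (k n : ℝ) ≤ (n - k n : ℕ) := Nat.cast_le.2 (by omega)
    have e2 : (1 - a) ^ T ≤ (1 - b) ^ T := pow_le_pow_left₀ (by linarith) (by linarith) T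
    have e3 : 0 ≤ (1 - a) ^ T := pow_nonneg (by linarith) T
    gcongr
  have hcorr : (1 + 4 * b * p) ^ T ≤ 5 / 4 := by
    have e1 : b * p ≤ 1 / (k n : ℝ) ^ 2 := by
      rw [le_div_iff₀ (by positivity)]
      calc b * p * (k n : ℝ) ^ 2 = (k n * p) ^ 2 * (1 - p) ^ k n := by rw [hb]; ring
        _ ≤ (k n * p) ^ 2 * Real.exp (-(k n * p)) := by
            gcongr; exact one_sub_pow_le_exp hp1.le _
        _ ≤ 1 := sq_mul_exp_neg_le_one (by positivity)
    have e2 : Real.log n ≤ (Real.log (k n) + c) / θ := by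
      rw [le_div_iff₀ h0]; linarith
    have e3 : T * (4 * b * p) ≤ Real.log (5 / 4) := by
      refine le_trans ?_ h4
      calc T * (4 * b * p) = T * (4 * (b * p)) := by ring
        _ ≤ T * (4 * (1 / (k n : ℝ) ^ 2)) := by gcongr
        _ ≤ k n * (((1 - θ) * ((Real.log (k n) + c) / θ) + c + 1) / (R * Real.log 2)) *
            (4 * (1 / (k n : ℝ) ^ 2)) := by
            refine mul_le_mul_of_nonneg_right (hTk.trans ?_) (by positivity)
            gcongr
        _ = _ := by field_simp
    calc (1 + 4 * b * p) ^ T ≤ Real.exp (4 * b * p) ^ T := by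
          have := Real.add_one_le_exp (4 * b * p)
          gcongr
          linarith
      _ = Real.exp (T * (4 * b * p)) := (Real.exp_nat_mul _ _).symm
      _ ≤ 5 / 4 := by
          rw [← Real.exp_log (by norm_num : (0 : ℝ) < 5 / 4), Real.exp_le_exp]
          exact e3
  -- The constants combine to (1 - 1/8 - 1/8 - 1/4)/2 = 1/4.
  have hfin := le_errorProb_of_masked hp0 hp1.le hk2 (by omega) D haeq ha2 hb.symm (by linarith)
  have i1 : 1 / (k n * (1 - a) ^ T) ≤ 1 / 8 := one_div_le_one_div_of_le (by norm_num) hmask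
  have i2 : 1 / (((n - k n : ℕ) : ℝ) * (1 - b) ^ T) ≤ 1 / 8 :=
    one_div_le_one_div_of_le (by norm_num) hhid
  linarith

/-- Converse: no detector achieves a rate above the capacity. -/
theorem AchievesRate.le_capacity {D : ∀ n T, Detector n T} (hD : AchievesRate k D R)
    (h : SparseBounds θ k c) (h0 : 0 ≤ θ) (hθ : θ < 1) : R ≤ capacity θ := by
  by_contra! hCR
  obtain ⟨hR, T, p, hp, hT, hlim⟩ := hD
  have hl2 : 0 < Real.log 2 := Real.log_pos one_lt_two
  have hC := capacity_pos h0 hθ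
  obtain ⟨g, hg, hA⟩ := exists_success_le h hθ hR hCR
  -- At θ = 0 only the entropy obstruction is needed.
  have hB : ∀ᶠ n : ℕ in atTop, θ ≠ 0 → ∀ (T : ℕ) (p : ℝ) (D : Detector n T), 0 ≤ p → p < 1 →
      (T : ℝ) ≤ Real.logb 2 (n.choose (k n)) / R →
      k n * (p * (1 - p) ^ k n) ≤ capacity θ * (θ * Real.log 2 / (1 - θ)) →
      1 / 4 ≤ errorProb p (k n) D := by
    by_cases hz : θ = 0
    · exact Eventually.of_forall fun n hn => absurd hz hn
    · exact (eventually_quarter_le_errorProb h (lt_of_le_of_ne h0 (Ne.symm hz)) hθ hC hCR).mono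
        fun n hn _ => hn
  have hfalse : ∀ᶠ n : ℕ in atTop, False := by
    filter_upwards [hA, hB, hT, h.one_le, hlim.eventually_lt_const (show (0 : ℝ) < 1 / 4 by norm_num),
      hg.eventually_lt_const (show (0 : ℝ) < 1 / 2 by norm_num)] with n hAn hBn hTn hkn he hgn
    have hk0 : (0 : ℝ) < k n := by exact_mod_cast hkn
    obtain ⟨hp0, hp1⟩ := hp n
    have hent : capacity θ * Real.log 2 < Real.binEntropy ((1 - p n) ^ k n) := by
      by_contra! hle
      have := hAn (T n) (p n) (D n (T n)) hp0 hp1 hTn hle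
      linarith
    -- Positive entropy excludes p = 0 and p = 1, so ν below is a genuine positive number.
    have hpos : 0 < Real.binEntropy ((1 - p n) ^ k n) := (mul_pos hC hl2).trans hent
    have hp1' : p n < 1 := by
      refine lt_of_le_of_ne hp1 fun hp => ?_
      rw [hp, sub_self, zero_pow (by omega), Real.binEntropy_zero] at hpos
      exact lt_irrefl _ hpos
    have hp0' : 0 < p n := by
      refine lt_of_le_of_ne hp0 fun hp => ?_
      rw [← hp, sub_zero, one_pow, Real.binEntropy_one] at hpos
      exact lt_irrefl _ hpos
    have h1p : 0 < 1 - p n := by linarith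
    have hlogp : p n ≤ -Real.log (1 - p n) := by linarith [Real.log_le_sub_one_of_pos h1p]
    set ν := k n * -Real.log (1 - p n) with hν
    have hν0 : 0 < ν := mul_pos hk0 (by linarith)
    have hexp : Real.exp (-ν) = (1 - p n) ^ k n := by
      rw [hν, mul_neg, neg_neg, Real.exp_nat_mul, Real.exp_log h1p]
    have hterm := (isGreatest_capacity h0 hθ).2 ⟨ν, Set.mem_Ioi.2 hν0, rfl⟩
    rw [capacityTerm, hexp] at hterm
    have hh : capacity θ < GroupTesting.h ((1 - p n) ^ k n) := by
      rwa [GroupTesting.h, lt_div_iff₀ hl2]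
    split_ifs at hterm with hz
    · linarith
    · rw [min_le_iff] at hterm
      rcases hterm with hterm | hterm
      · have hθ0 : 0 < θ := lt_of_le_of_ne h0 (Ne.symm hz)
        have h1θ : 0 < 1 - θ := by linarith
        -- kp ≤ ν because p ≤ -log(1 - p), so the masking term at ν bounds kp(1 - p)^k.
        have hle : k n * (p n * (1 - p n) ^ k n) ≤ capacity θ * (θ * Real.log 2 / (1 - θ)) := by
          rw [div_mul_div_comm, div_le_iff₀ (by positivity)] at hterm
          rw [← mul_div_assoc, le_div_iff₀ h1θ]
          calc k n * (p n * (1 - p n) ^ k n) * (1 - θ)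
              ≤ ν * (1 - p n) ^ k n * (1 - θ) := by
                rw [hν, ← mul_assoc]; gcongr
            _ ≤ capacity θ * (Real.log 2 * θ) := hterm
            _ = _ := by ring
        have := hBn hz (T n) (p n) (D n (T n)) hp0 hp1' hTn hle
        linarith
      · linarith
  exact hfalse.exists.elim fun _ hf => hf

end converse

/-! ### Both suprema from achievability and the converse. -/

theorem isLUB_of_Ioo_subset {A : Set ℝ} {C : ℝ} (hC : 0 < C) (hub : ∀ R ∈ A, R ≤ C)
    (hsub : ∀ R, 0 < R → R < C → R ∈ A) : IsLUB A C := by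
  refine ⟨fun R hR => hub R hR, fun B hB => le_of_forall_lt fun R hR => ?_⟩
  obtain ⟨R', h1, h2⟩ := exists_between (max_lt hR hC)
  rw [max_lt_iff] at h1
  exact h1.1.trans_le (hB (hsub R' h1.2 h2))

end GroupTesting

theorem mainTheorem7 (θ : ℝ) (hθ₀ : 0 ≤ θ) (hθ₁ : θ < 1) (k : ℕ → ℕ)
    (hk : (fun n : ℕ => (k n : ℝ)) =Θ[atTop] fun n : ℕ => (n : ℝ) ^ θ)
    (S : ∀ n T, GroupTesting.Detector n T) (hS : ∀ n T, GroupTesting.IsSSS (S n T)) :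
    IsLUB {R : ℝ | GroupTesting.RateAchievable k R} (GroupTesting.capacity θ) ∧
      IsLUB {R : ℝ | GroupTesting.AchievesRate k S R} (GroupTesting.capacity θ) := by
  obtain ⟨c, hc⟩ := GroupTesting.exists_sparseBounds hθ₁ hk
  have hpos := GroupTesting.capacity_pos hθ₀ hθ₁
  constructor
  · refine GroupTesting.isLUB_of_Ioo_subset hpos ?_ fun R h0 h1 =>
      ⟨S, GroupTesting.achievesRate_of_lt_capacity hS hc hθ₀ hθ₁ h0 h1⟩
    rintro R ⟨D, hD⟩
    exact hD.le_capacity hc hθ₀ hθ₁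
  · exact GroupTesting.isLUB_of_Ioo_subset hpos (fun R hR => hR.le_capacity hc hθ₀ hθ₁)
      fun R h0 h1 => GroupTesting.achievesRate_of_lt_capacity hS hc hθ₀ hθ₁ h0 h1
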